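/- Variables are named by binary words. A literal is a variable $x$ (positive) or its negation $\neg x$ (negative), a clause is a finite set of literals, and a CNF formula is a finite set of clauses. A CNF default theory $T=\langle W,D\rangle$ consists of a finite set $W$ of CNF formulas and a finite set $D=\{\delta_1,\dots,\delta_n\}$ of default rules $\delta_i=\frac{\alpha:\beta}{\gamma}$ with CNF formulas $\alpha,\beta,\gamma$. It is a $\Theta$ default theory, for a class $\Theta$ of CNF formulas, if all formulas occurring in it belong to $\Theta$. The target classes are: $\mathrm{Horn}$ (every clause has at most one positive literal), $\mathrm{ID}$ (every clause has at most one literal, and only a positive one), $\mathrm{Krom}$ (every clause has at most two literals), and $\mathrm{Monotone}$ (all literals are positive). An extended literal is a literal $\ell$ or a symbol $x_\varepsilon$ for a variable $x$. The reduct of a formula with respect to a literal $\ell$ is obtained by deleting all clauses containing $\ell$ and deleting the complement of $\ell$ from the remaining clauses; the reduct with respect to $x_\varepsilon$ is obtained by deleting $x$ and $\neg x$ from all clauses. The reduct of a theory $\langle W,D\rangle$ replaces $W$ by the union of the reducts of its formulas, and replaces $\alpha,\beta,\gamma$ in each rule $\delta_i$ by their reducts, adding to the reduct of $\gamma$ the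 unit clause $\{y_i\}$, where $y_i$ is a fresh variable. A set $B$ of variables of $T$ is a strong $\Theta$-backdoor of $T$ if, for every set $Y$ that contains exactly one of $x,\neg x,x_\varepsilon$ for each $x\in B$ and nothing else, the theory obtained from $T$ by taking the reducts with respect to the elements of $Y$ one after the other is a $\Theta$ default theory. A parameterised problem $L\subseteq\Sigma^*\times\mathbb N$ is in $\mathrm{FPT}=\mathrm{para\text{-}P}$ if there are a finite alphabet $\Sigma'$, a computable function $f:\mathbb N\to\Sigma'^*$ and a polynomial-time decidable problem $L'\subseteq\Sigma^*\times\Sigma'^*$ such that $(x,k)\in L\iff(x,f(k))\in L'$ for all $x$ and $k$. **Theorem.** (1) For every $\mathcal C\in\{\mathrm{Horn},\mathrm{ID},\mathrm{Krom},\mathrm{Monotone}\}$, the problem of deciding, given a CNF default theory $T$ and $k\in\mathbb N$, whether $T$ has a strong $\mathcal C$-backdoor of size at most $k$, parameterised by $k$, is in $\mathrm{FPT}$. (2) Let $T$ be a CNF default theory and $B$ a set of variables of $T$. - $B$ is a strong $\mathrm{Horn}$-backdoor of $T$ if and only if $B$ is a vertex cover of the graph on the variables in which two distinct variables $x,y$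 are adjacent when some clause of a formula of $T$ contains both positive literals $x$ and $y$. - $B$ is a strong $\mathrm{ID}$-backdoor of $T$ if and only if $B$ is a vertex cover of the graph in which two distinct variables are adjacent when both occur (positively or negatively) in a common clause of a formula of $T$, and in addition $B$ contains every variable $x$ for which $\neg x$ occurs in $T$ (that is, if and only if $B$ is a vertex cover of this graph with loops added at these variables $x$). - If no clause of $T$ contains a literal together with its complement, then $B$ is a strong $\mathrm{Krom}$-backdoor of $T$ if and only if $B$ meets every hyperedge of the hypergraph whose hyperedges are the sets of three distinct variables occurring in a common clause of a formula of $T$. - $B$ is a strong $\mathrm{Monotone}$-backdoor of $T$ if and only if $B$ contains every variable $x$ for which $\neg x$ occurs in $T$. -/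

import Mathlib

namespace DefaultLogic

/-! ### Parameterised complexity -/

/-- `S ∈ P`, where the elements of `α` are written as words by the encoding `e` over a finite
alphabet: some (finite, multi-stack) Turing machine decides membership in `S` within a number of
steps that is polynomial in the length of the input word. -/
def InP {α Γ : Type} [Fintype Γ] (e : Computability.Encoding α Γ) (S : Set α) : Prop :=
  ∃ χ : α → Bool, (∀ a, χ a = true ↔ a ∈ S) ∧
    Nonempty (Turing.TM2ComputableInPolyTime e.encode Computability.encodeBool χ)

/-- A parameterised problem `L ⊆ Σ* × ℕ` is in `FPT = para-P` if there are a finite alphabet `Σ'`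
(without loss of generality `Fin m`), a computable `f : ℕ → Σ'*` and a problem
`L' ⊆ Σ* × Σ'*` in `P` such that `(x, k) ∈ L ↔ (x, f k) ∈ L'` for all `(x, k)`. -/
def FPT {A : Type} [Fintype A] (L : Set (List A × ℕ)) : Prop :=
  ∃ (m : ℕ) (f : ℕ → List (Fin m)) (L' : Set (List A × List (Fin m))),
    Computable f ∧
    InP (Computability.encodingProd (Computability.encodingList A)
      (Computability.encodingList (Fin m))) L' ∧
    ∀ (x : List A) (k : ℕ), (x, k) ∈ L ↔ (x, f k) ∈ L'

/-! ### Propositional formulas in conjunctive normal form -/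

/-- A propositional variable, identified with its name, a binary word. -/
abbrev Var := List Bool

/-- The literal `x` (if `pos = true`) or `¬ x` (if `pos = false`), for `x = var`. -/
structure Lit where
  var : Var
  pos : Bool
  deriving DecidableEq

/-- The complementary literal. -/
def Lit.neg (l : Lit) : Lit := ⟨l.var, !l.pos⟩

/-- A clause is a finite set of literals (their disjunction). -/
abbrev Clause := Finset Lit

/-- A formula in conjunctive normal form is a finite set of clauses (their conjunction). -/
abbrev CNF := Finset Clause

/-- The set of variables occurring in a formula. -/
def CNF.vars (φ : CNF) : Finset Var := φ.biUnion fun C => C.image Lit.var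

/-- Every clause contains at most one positive literal. -/
def Horn : Set CNF := {φ | ∀ C ∈ φ, (C.filter fun l => l.pos = true).card ≤ 1}

/-- Every clause contains at most two literals. -/
def Krom : Set CNF := {φ | ∀ C ∈ φ, C.card ≤ 2}

/-- Every clause contains only positive literals. -/
def Monotone : Set CNF := {φ | ∀ C ∈ φ, ∀ l ∈ C, l.pos = true}

/-- Positive unit formulas: every clause contains at most one literal, and only a positive one.
(As for the other classes, the empty clause is allowed, so that the class is closed under
subformulas.) -/
def PosUnit : Set CNF := {φ | ∀ C ∈ φ, C.card ≤ 1 ∧ ∀ l ∈ C, l.pos = true}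

/-! ### Default theories -/

/-- The default rule `prereq : just / concl`. -/
structure DefaultRule where
  prereq : CNF
  just : CNF
  concl : CNF

/-- A CNF default theory `⟨W, D⟩`. The finite set `D = {δ₀, δ₁, …}` of default rules is given by an
enumeration, since the reduct refers to the index `i` of the rule `δᵢ`. -/
structure DefaultTheory where
  W : Finset CNF
  D : List DefaultRule

namespace DefaultTheory

/-- All formulas occurring in the theory. -/
def formulas (T : DefaultTheory) : Finset CNF :=
  T.W ∪ (T.D.flatMap fun d => [d.prereq, d.just, d.concl]).toFinset

/-- The set of variables occurring in the theory. -/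
def vars (T : DefaultTheory) : Finset Var := T.formulas.biUnion CNF.vars

/-- `T` is a `Θ`-default theory. -/
def IsIn (T : DefaultTheory) (Θ : Set CNF) : Prop :=
  (∀ φ ∈ T.W, φ ∈ Θ) ∧ ∀ d ∈ T.D, d.prereq ∈ Θ ∧ d.just ∈ Θ ∧ d.concl ∈ Θ

/-- No clause of `T` contains a literal together with its complement. -/
def TautologyFree (T : DefaultTheory) : Prop :=
  ∀ φ ∈ T.formulas, ∀ C ∈ φ, ∀ l ∈ C, l.neg ∉ C

end DefaultTheory

/-! ### Extended literals, reducts and strong backdoors -/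

/-- An extended literal: a literal, or the symbol `x_ε` for a variable `x`. -/
inductive ExtLit
  | lit (l : Lit)
  | eps (x : Var)

/-- The variable of an extended literal. -/
def ExtLit.var : ExtLit → Var
  | .lit l => l.var
  | .eps x => x

/-- The reduct of a formula: for a literal `l`, all clauses containing `l` are deleted and the
complement of `l` is deleted from all clauses; for `x_ε`, the literals `x` and `¬ x` are deleted
from all clauses. -/
def CNF.reduct (φ : CNF) : ExtLit → CNF
  | .lit l => (φ.filter fun C => l ∉ C).image fun C => C.erase l.neg
  | .eps x => φ.image fun C => C.filter fun l => l.var ≠ x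

/-- The reduct of a default theory with respect to one extended literal; the knowledge base becomes
the union of the reducts of its formulas, and the positive unit clause `yᵢ` is added to the
conclusion of the reduct of the rule `δᵢ`. -/
def DefaultTheory.reduct (y : ℕ → Var) (T : DefaultTheory) (e : ExtLit) : DefaultTheory where
  W := {T.W.biUnion fun φ => φ.reduct e}
  D := T.D.mapIdx fun i d =>
    ⟨d.prereq.reduct e, d.just.reduct e, insert {⟨y i, true⟩} (d.concl.reduct e)⟩

/-- The consecutive application of the reducts with respect to a list of extended literals. -/
def DefaultTheory.reducts (y : ℕ → Var) (T : DefaultTheory) (Y : List ExtLit) : DefaultTheory :=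
  Y.foldl (DefaultTheory.reduct y) T

/-- `Y` lists (in some order) a threefold assignment of `B`: for each `x ∈ B` it contains exactly
one of `x`, `¬ x`, `x_ε`, and nothing else. -/
def IsThreefold (B : Finset Var) (Y : List ExtLit) : Prop :=
  (Y.map ExtLit.var).Nodup ∧ (Y.map ExtLit.var).toFinset = B

/-- `B` is a strong `Θ`-backdoor of `T`: `B` is a set of variables of `T`, and, the `yᵢ` being
distinct variables that do not occur in `T`, all reducts of `T` with respect to threefold
assignments of `B` are `Θ`-default theories. -/
def IsStrongBackdoor (Θ : Set CNF) (T : DefaultTheory) (B : Finset Var) : Prop :=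
  B ⊆ T.vars ∧
  ∀ y : ℕ → Var, Function.Injective y → (∀ i, y i ∉ T.vars) →
    ∀ Y : List ExtLit, IsThreefold B Y → (T.reducts y Y).IsIn Θ

/-! ### Default theories as words, and the detection problem -/

/-- The alphabet in which default theories are written. -/
inductive Sym
  | sign (b : Bool)
  | bit (b : Bool)
  | endClause
  | endFormula
  | endW
  deriving DecidableEq, Fintype

/-- A formula, written down as a list of clauses, each of which is a list of literals. -/
abbrev CNFCode := List (List Lit)

/-- The formula that is written down. -/
def CNFCode.toCNF (c : CNFCode) : CNF := (c.map List.toFinset).toFinset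

/-- A literal is written as its sign followed by the name of its variable. -/
def litWord (l : Lit) : List Sym := .sign l.pos :: l.var.map Sym.bit

/-- A clause is written as its literals one after the other, followed by an end mark. -/
def clauseWord (c : List Lit) : List Sym := c.flatMap litWord ++ [.endClause]

/-- A formula is written as its clauses one after the other, followed by an end mark. -/
def CNFCode.word (c : CNFCode) : List Sym := c.flatMap clauseWord ++ [.endFormula]

/-- A default theory, written down as the list of the formulas in `W` and the list of the triples
(prerequisite, justification, conclusion) in `D`. -/
structure TheoryCode where
  W : List CNFCode
  D : List (CNFCode × CNFCode × CNFCode)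

/-- The default theory that is written down. -/
def TheoryCode.theory (c : TheoryCode) : DefaultTheory where
  W := (c.W.map CNFCode.toCNF).toFinset
  D := c.D.map fun r => ⟨r.1.toCNF, r.2.1.toCNF, r.2.2.toCNF⟩

/-- The word of a default theory: the formulas in `W`, an end mark, and then the default rules,
each of them as three consecutive formulas. -/
def TheoryCode.word (c : TheoryCode) : List Sym :=
  c.W.flatMap CNFCode.word ++ .endW ::
    c.D.flatMap fun r => r.1.word ++ r.2.1.word ++ r.2.2.word

/-- Backdoor detection: given a CNF default theory `T` (as a word) and `k`, the parameter, does `T`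
have a strong `Θ`-backdoor of size at most `k`? -/
def BackdoorDetection (Θ : Set CNF) : Set (List Sym × ℕ) :=
  {p | ∃ c : TheoryCode, c.word = p.1 ∧
    ∃ B : Finset Var, IsStrongBackdoor Θ c.theory B ∧ B.card ≤ p.2}

/-! ### (Hyper)graphs of a default theory -/

/-- Two distinct variables are joined if some clause contains both as positive literals. -/
def hornGraph (T : DefaultTheory) : SimpleGraph Var where
  Adj x z := x ≠ z ∧ ∃ φ ∈ T.formulas, ∃ C ∈ φ, (⟨x, true⟩ : Lit) ∈ C ∧ (⟨z, true⟩ : Lit) ∈ C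
  symm := ⟨fun _ _ ⟨h, φ, hφ, C, hC, hx, hz⟩ => ⟨h.symm, φ, hφ, C, hC, hz, hx⟩⟩
  loopless := ⟨fun _ h => h.1 rfl⟩

/-- Two distinct variables are joined if both occur in a common clause. -/
def primalGraph (T : DefaultTheory) : SimpleGraph Var where
  Adj x z := x ≠ z ∧ ∃ φ ∈ T.formulas, ∃ C ∈ φ, x ∈ C.image Lit.var ∧ z ∈ C.image Lit.var
  symm := ⟨fun _ _ ⟨h, φ, hφ, C, hC, hx, hz⟩ => ⟨h.symm, φ, hφ, C, hC, hz, hx⟩⟩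
  loopless := ⟨fun _ h => h.1 rfl⟩

/-- The 3-uniform hypergraph whose hyperedges are the sets of three distinct variables that occur
in a common clause. -/
def kromHypergraph (T : DefaultTheory) : Set (Finset Var) :=
  {e | e.card = 3 ∧ ∃ φ ∈ T.formulas, ∃ C ∈ φ, e ⊆ C.image Lit.var}

/-- `B` meets all hyperedges. -/
def IsHittingSet (E : Set (Finset Var)) (B : Finset Var) : Prop := ∀ e ∈ E, (e ∩ B).Nonempty

/-- The variables `x` such that `¬ x` occurs in some clause. -/
def negVars (T : DefaultTheory) : Set Var :=
  {x | ∃ φ ∈ T.formulas, ∃ C ∈ φ, (⟨x, false⟩ : Lit) ∈ C}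

end DefaultLogic

/-!
Reducts only delete literals or clauses and add positive unit clauses, so a strong backdoor `B` can
be tested on the clauses of the theory with the variables of `B` deleted: part (2) is a matter of
comparing these clauses with the defining edges.

Each target class consists of the formulas all of whose clauses have weight less than a threshold,
where the weight of a clause is the sum of weights depending only on the signs of its literals. A
heavy clause has a bounded number of literals that are already too heavy together, so a strong
backdoor contains the variable of one of them; branching on these literals gives a search tree with
boundedly many children per node and depth `k`. The list of all branches of this tree depends only
on `k` and is taken as the advice `f k`, so that what remains to be decided, namely whether some
listed branch produces a strong backdoor, is decidable in polynomial time. Polynomial running times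
are obtained by closure properties of a class of functions on binary trees that are computed by
structured programs, which in turn are compiled to multi-stack Turing machines.
-/

/-! ### Structured programs and Turing machines -/

/-- Structured programs for a multi-stack machine with stacks `k : K` over the alphabets `Γ k` and a
register with values in `σ`. They compile to Mathlib's `Turing.TM2` machines. -/
inductive StackProgram {K : Type} (Γ : K → Type) (σ : Type)
  | pop (k : K) (f : σ → Option (Γ k) → σ)
  | push (k : K) (f : σ → Γ k)
  | load (f : σ → σ)
  | seq (c d : StackProgram Γ σ)
  | ite (p : σ → Bool) (c d : StackProgram Γ σ)
  | loop (p : σ → Bool) (c : StackProgram Γ σ)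

namespace StackProgram

open Turing Function StateTransition

variable {K : Type} {Γ : K → Type} {σ : Type}

infixr:65 " ;; " => StackProgram.seq

/-- The content of the register and of the stacks. -/
abbrev State (Γ : K → Type) (σ : Type) := σ × ∀ k, List (Γ k)

/-- `Runs c s s' n`: started in the state `s`, the program `c` terminates in the state `s'` after at
most `n` steps. -/
inductive Runs [DecidableEq K] : StackProgram Γ σ → State Γ σ → State Γ σ → ℕ → Prop
  | pop {k f v S} : Runs (pop k f) (v, S) (f v (S k).head?, update S k (S k).tail) 1
  | push {k f v S} : Runs (push k f) (v, S) (v, update S k (f v :: S k)) 1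
  | load {f v S} : Runs (load f) (v, S) (f v, S) 1
  | seq {c d s s' s'' m n} : Runs c s s' m → Runs d s' s'' n → Runs (c ;; d) s s'' (n + m)
  | ite_true {p c d s s' n} : p s.1 = true → Runs c s s' n → Runs (ite p c d) s s' (n + 1)
  | ite_false {p c d s s' n} : p s.1 = false → Runs d s s' n → Runs (ite p c d) s s' (n + 1)
  | loop_done {p c s} : p s.1 = false → Runs (loop p c) s s 1
  | loop_step {p c s s' s'' m n} : p s.1 = true → Runs c s s' m → Runs (loop p c) s' s'' n →
      Runs (loop p c) s s'' (n + m + 1)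
  | mono {c s s' m n} : Runs c s s' m → m ≤ n → Runs c s s' n

theorem Runs.length_le [DecidableEq K] {c : StackProgram Γ σ} {s s' : State Γ σ} {n : ℕ}
    (h : Runs c s s' n) (k : K) : (s'.2 k).length ≤ (s.2 k).length + n := by
  induction h with
  | @pop k' f v S =>
    dsimp only
    obtain rfl | hk := eq_or_ne k k'
    · rw [update_self, List.length_tail]; omega
    · rw [update_of_ne hk]; omega
  | @push k' f v S =>
    dsimp only
    obtain rfl | hk := eq_or_ne k k'
    · rw [update_self, List.length_cons]
    · rw [update_of_ne hk]; exact Nat.le_succ _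
  | load => exact Nat.le_add_right _ _
  | _ => omega

/-- The labels of the compiled program: one for each place at which it takes a step. -/
def Label : StackProgram Γ σ → Type
  | pop _ _ | push _ _ | load _ => Unit
  | seq c d => Label c ⊕ Label d
  | ite _ c d => Option (Label c ⊕ Label d)
  | loop _ c => Option (Label c)

instance fintypeLabel : ∀ c : StackProgram Γ σ, Fintype (Label c)
  | pop _ _ | push _ _ | load _ => inferInstanceAs (Fintype Unit)
  | seq c d =>
    have := fintypeLabel c
    have := fintypeLabel d
    inferInstanceAs (Fintype (Label c ⊕ Label d))
  | ite _ c d =>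
    have := fintypeLabel c
    have := fintypeLabel d
    inferInstanceAs (Fintype (Option (Label c ⊕ Label d)))
  | loop _ c =>
    have := fintypeLabel c
    inferInstanceAs (Fintype (Option (Label c)))

/-- The label at which the compiled program starts. -/
def entry : ∀ c : StackProgram Γ σ, Label c
  | pop _ _ | push _ _ | load _ => ()
  | seq c _ => .inl (entry c)
  | ite _ _ _ | loop _ _ => none

/-- The statement at each label of the compiled program, whose labels are embedded into the labels
`Λ` of a machine by `emb`; the machine continues at the label `exit`. -/
def compile {Λ : Type} :
    ∀ c : StackProgram Γ σ, (Label c → Λ) → Λ → Label c → TM2.Stmt Γ Λ σ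
  | pop k f, _, exit, _ => .pop k f (.goto fun _ => exit)
  | push k f, _, exit, _ => .push k f (.goto fun _ => exit)
  | load f, _, exit, _ => .load f (.goto fun _ => exit)
  | seq c d, emb, _, .inl l => compile c (emb ∘ .inl) (emb (.inr (entry d))) l
  | seq _ d, emb, exit, .inr l => compile d (emb ∘ .inr) exit l
  | ite p c d, emb, _, none =>
      .branch p (.goto fun _ => emb (some (.inl (entry c))))
        (.goto fun _ => emb (some (.inr (entry d))))
  | ite _ c _, emb, exit, some (.inl l) => compile c (emb ∘ some ∘ .inl) exit l
  | ite _ _ d, emb, exit, some (.inr l) => compile d (emb ∘ some ∘ .inr) exit l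
  | loop p c, emb, exit, none =>
      .branch p (.goto fun _ => emb (some (entry c))) (.goto fun _ => exit)
  | loop _ c, emb, _, some l => compile c (emb ∘ some) (emb none) l

variable [DecidableEq K]

omit [DecidableEq K] in
theorem nonempty_evalsToInTime_of_step {α : Type} {f : α → Option α} {a b : α} (h : f a = some b) :
    Nonempty (EvalsToInTime f a (some b) 1) :=
  ⟨⟨⟨1, h⟩, le_rfl⟩⟩

theorem Runs.nonempty_evalsToInTime {Λ : Type} {M : Λ → TM2.Stmt Γ Λ σ} {c : StackProgram Γ σ}
    {s s' : State Γ σ} {n : ℕ} (h : Runs c s s' n) {emb : Label c → Λ} {exit : Λ}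
    (hM : ∀ l, M (emb l) = compile c emb exit l) :
    Nonempty (EvalsToInTime (TM2.step M) ⟨some (emb (entry c)), s.1, s.2⟩
      (some ⟨some exit, s'.1, s'.2⟩) n) := by
  have step (l) (s : State Γ σ) : TM2.step M ⟨some (emb l), s.1, s.2⟩ =
      some (TM2.stepAux (compile c emb exit l) s.1 s.2) := by rw [← hM, TM2.step]
  induction h generalizing exit with
  | pop | push | load => exact nonempty_evalsToInTime_of_step (step _ _)
  | seq _ _ ihc ihd =>
    obtain ⟨hc⟩ := ihc (fun l => hM (.inl l)) fun l => step (.inl l)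
    obtain ⟨hd⟩ := ihd (fun l => hM (.inr l)) fun l => step (.inr l)
    exact ⟨hc.trans _ _ _ _ _ _ hd⟩
  | @ite_true _ _ _ s _ _ hp _ ih =>
    obtain ⟨hbranch⟩ := nonempty_evalsToInTime_of_step ((step none s).trans (by
      rw [compile, TM2.stepAux, hp, cond_true, TM2.stepAux]))
    obtain ⟨hc⟩ := ih (fun l => hM (some (.inl l))) fun l => step (some (.inl l))
    exact ⟨hbranch.trans _ _ _ _ _ _ hc⟩
  | @ite_false _ _ _ s _ _ hp _ ih =>
    obtain ⟨hbranch⟩ := nonempty_evalsToInTime_of_step ((step none s).trans (by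
      rw [compile, TM2.stepAux, hp, cond_false, TM2.stepAux]))
    obtain ⟨hd⟩ := ih (fun l => hM (some (.inr l))) fun l => step (some (.inr l))
    exact ⟨hbranch.trans _ _ _ _ _ _ hd⟩
  | @loop_done _ _ s hp =>
    exact nonempty_evalsToInTime_of_step ((step none s).trans (by
      rw [compile, TM2.stepAux, hp, cond_false, TM2.stepAux]))
  | @loop_step _ _ s _ _ _ _ hp _ _ ihbody ihloop =>
    obtain ⟨hbranch⟩ := nonempty_evalsToInTime_of_step ((step none s).trans (by
      rw [compile, TM2.stepAux, hp, cond_true, TM2.stepAux]))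
    obtain ⟨hbody⟩ := ihbody (fun l => hM (some l)) fun l => step (some l)
    obtain ⟨hloop⟩ := ihloop hM step
    exact ⟨hbranch.trans _ _ _ _ _ _ (hbody.trans _ _ _ _ _ _ hloop)⟩
  | mono _ hmn ih =>
    obtain ⟨h⟩ := ih hM step
    exact ⟨⟨h.toEvalsTo, h.steps_le_m.trans hmn⟩⟩

/-- The Turing machine that executes the program `c` with input stack `inp` and output stack `out`,
and finally resets the register. -/
def toFinTM2 [Fintype K] [Fintype σ] (c : StackProgram Γ σ) (inp out : K) [Fintype (Γ inp)]
    (v₀ : σ) : FinTM2 where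
  K := K
  k₀ := inp
  k₁ := out
  Γ := Γ
  Λ := Option (Label c)
  main := some (entry c)
  σ := σ
  initialState := v₀
  m
    | some l => compile c some none l
    | none => .load (fun _ => v₀) .halt

/-- The stacks of which only `k` is possibly non-empty. -/
def single (k : K) (w : List (Γ k)) : ∀ k, List (Γ k) := update (fun _ => []) k w

theorem single_eq_dite (k : K) (w : List (Γ k)) :
    single k w = fun k' => if h : k' = k then (by rw [h]; exact w) else [] := by
  funext k'
  obtain rfl | h := eq_or_ne k' k <;> simp [single, *]

theorem tm2ComputableInPolyTime [Finite K] [Finite σ] {α β : Type} {inp out : K}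
    [Finite (Γ inp)] {ea : α → List (Γ inp)} {eb : β → List (Γ out)} {f : α → β}
    (c : StackProgram Γ σ) (v₀ : σ) (time : Polynomial ℕ)
    (hc : ∀ a, ∃ v, Runs c (v₀, single inp (ea a)) (v, single out (eb (f a)))
      (time.eval (ea a).length)) :
    Nonempty (TM2ComputableInPolyTime ea eb f) := by
  have := Fintype.ofFinite K
  have := Fintype.ofFinite σ
  have := Fintype.ofFinite (Γ inp)
  refine ⟨⟨⟨c.toFinTM2 inp out v₀, .refl _, .refl _⟩, time + 1, fun a => Classical.choice ?_⟩⟩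
  obtain ⟨v, hv⟩ := hc a
  obtain ⟨hrun⟩ := hv.nonempty_evalsToInTime (M := (c.toFinTM2 inp out v₀).m)
    (emb := some) (exit := none) fun _ => rfl
  have hhalt : EvalsToInTime (c.toFinTM2 inp out v₀).step ⟨some none, v, single out (eb (f a))⟩
      (some ⟨none, v₀, single out (eb (f a))⟩) 1 := ⟨⟨1, rfl⟩, le_rfl⟩
  have hinit : initList (c.toFinTM2 inp out v₀) ((ea a).map id) =
      ⟨some (some (entry c)), v₀, single inp (ea a)⟩ :=
    (congrArg (initList _) (List.map_id (ea a))).trans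
      (congrArg (TM2.Cfg.mk _ _) (single_eq_dite inp (ea a)).symm)
  have hfinal : haltList (c.toFinTM2 inp out v₀) ((eb (f a)).map id) =
      ⟨none, v₀, single out (eb (f a))⟩ :=
    (congrArg (haltList _) (List.map_id (eb (f a)))).trans
      (congrArg (TM2.Cfg.mk _ _) (single_eq_dite out (eb (f a))).symm)
  have houtputs : EvalsToInTime (c.toFinTM2 inp out v₀).step
      (initList (c.toFinTM2 inp out v₀) ((ea a).map id))
      (some (haltList (c.toFinTM2 inp out v₀) ((eb (f a)).map id)))
      ((time + 1).eval (ea a).length) := by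
    rw [hinit, hfinal, Polynomial.eval_add, Polynomial.eval_one, add_comm]
    exact hrun.trans _ _ _ _ _ _ hhalt
  exact ⟨houtputs⟩

end StackProgram

/-! ### Programs on binary trees -/

/-- Binary trees with leaves labelled by `A`, the data that polynomial-time programs work on. -/
inductive Data (A : Type)
  | atom (a : A)
  | pair (x y : Data A)

/-- Prefix notation: `none` stands for an inner node. -/
def Data.word {A : Type} : Data A → List (Option A)
  | atom a => [some a]
  | pair x y => none :: (x.word ++ y.word)

/-- The stacks of the machines that work on `Data A`. Between two basic operations only `main` is
in use; `count` holds the number of subtrees still to be read, in unary. -/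
inductive DataStack
  | inp
  | main
  | aux (b : Bool)
  | count
  | out
  deriving DecidableEq, Fintype

namespace DataStack

open Function StackProgram

/-- The alphabets of the stacks. -/
abbrev Alphabet (A : Type) : DataStack → Type
  | inp => A
  | main | aux _ => Option A
  | count => Unit
  | out => Bool

/-- A program on trees. Its register holds the symbol popped last, or `none` if the stack was
empty. -/
abbrev Program (A : Type) := StackProgram (Alphabet A) (Option (Option A))

variable {A : Type}

/-- The content of the stacks when `inp` and `out` are empty. -/
def contents (m : List (Option A)) (aux : Bool → List (Option A)) (n : List Unit) :
    ∀ k, List (Alphabet A k)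
  | .main => m
  | .aux b => aux b
  | .count => n
  | .inp | .out => []

section Stacks

variable (m m' : List (Option A)) (x : Bool → List (Option A)) (n n' : List Unit)

@[simp]
theorem update_contents_main : update (contents m x n) main m' = contents m' x n := by
  funext k; cases k <;> rfl

@[simp]
theorem update_contents_aux (b : Bool) (w : List (Option A)) :
    update (contents m x n) (aux b) w = contents m (update x b w) n := by
  funext k
  cases k with
  | aux b' => obtain rfl | h := eq_or_ne b' b <;> simp [contents, *]
  | _ => rfl

@[simp]
theorem update_contents_count : update (contents m x n) count n' = contents m x n' := by
  funext k; cases k <;> rfl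

theorem single_main : single main m = contents m (fun _ => []) [] := by
  funext k; cases k <;> rfl

variable {m x n} {v : Option (Option A)}

theorem runs_pop_main {s : Option A} (f) :
    Runs (pop main f) (v, contents (s :: m) x n) (f v (some s), contents m x n) 1 := by
  simpa [contents] using Runs.pop (k := main) (f := f) (v := v) (S := contents (s :: m) x n)

theorem runs_pop_aux (b : Bool) (f) :
    Runs (pop (aux b) f) (v, contents m x n)
      (f v (x b).head?, contents m (update x b (x b).tail) n) 1 := by
  simpa [contents] using Runs.pop (k := aux b) (f := f) (v := v) (S := contents m x n)

theorem runs_pop_count (f) :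
    Runs (pop count f) (v, contents m x n) (f v n.head?, contents m x n.tail) 1 := by
  simpa [contents] using Runs.pop (k := count) (f := f) (v := v) (S := contents m x n)

theorem runs_push_main (f) :
    Runs (push main f) (v, contents m x n) (v, contents (f v :: m) x n) 1 := by
  simpa [contents] using Runs.push (k := main) (f := f) (v := v) (S := contents m x n)

theorem runs_push_aux (b : Bool) (f) :
    Runs (push (aux b) f) (v, contents m x n)
      (v, contents m (update x b (f v :: x b)) n) 1 := by
  simpa [contents] using Runs.push (k := aux b) (f := f) (v := v) (S := contents m x n)

theorem runs_push_count (f) :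
    Runs (push count f) (v, contents m x n) (v, contents m x (f v :: n)) 1 := by
  simpa [contents] using Runs.push (k := count) (f := f) (v := v) (S := contents m x n)

end Stacks

/-- The result of writing `w` onto the auxiliary stacks selected by `p`, symbol by symbol. -/
def write (p : Bool → Bool) (w : List (Option A)) (x : Bool → List (Option A)) :
    Bool → List (Option A) :=
  fun b => bif p b then w.reverse ++ x b else x b

theorem write_append (p : Bool → Bool) (v w : List (Option A)) (x : Bool → List (Option A)) :
    write p (v ++ w) x = write p w (write p v x) := by
  funext b
  cases h : p b <;> simp [write, h]

/-- Pushes the symbol in the register onto the auxiliary stacks selected by `p`. -/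
def emit (p : Bool → Bool) : Program A :=
  (bif p false then push (aux false) (·.getD none) else load id) ;;
    bif p true then push (aux true) (·.getD none) else load id

theorem runs_emit (p : Bool → Bool) (s : Option A) (m x n) :
    Runs (emit p) (some s, contents m x n) (some s, contents m (write p [s] x) n) 2 := by
  have half (b : Bool) (x) : Runs (bif p b then push (aux b) (·.getD none) else load id)
      (some s, contents m x n) (some s, contents m (update x b (write p [s] x b)) n) 1 := by
    cases h : p b
    · simpa [write, h] using! Runs.load (f := id)
    · simpa [write, h] using! runs_push_aux b _
  have hwrite : write p [s] x =
      update (update x false (write p [s] x false)) true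
        (write p [s] (update x false (write p [s] x false)) true) := by
    funext b
    cases b <;> simp [write]
  rw [hwrite]
  exact (half false x).seq (half true _)

/-- Reads the trees on `main`, one for each element of `count` and one more if the register is not
`none`, and writes them onto the auxiliary stacks selected by `p`. -/
def readLoop (p : Bool → Bool) : Program A :=
  loop Option.isSome <| pop main (fun _ s => s) ;; emit p ;;
    ite (· matches some none) (push count (fun _ => ()) ;; push count fun _ => ()) (load id) ;;
      pop count fun _ s => s.map fun _ => none

theorem runs_readLoop (p : Bool → Bool) (t : Data A) {m x n s' k}
    (h : Runs (readLoop p) (n.head?.map fun _ => none, contents m (write p t.word x) n.tail) s' k) :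
    Runs (readLoop p) (some none, contents (t.word ++ m) x n) s' (k + 8 * t.word.length) := by
  induction t generalizing m x n k with
  | atom a =>
    exact ((Runs.loop_step rfl ((runs_pop_main _).seq ((runs_emit p _ _ _ _).seq
      ((Runs.ite_false rfl .load).seq (runs_pop_count _)))) h).mono (by simp [Data.word]))
  | pair y z ihy ihz =>
    have hsubtrees : Runs (readLoop p)
        (some none, contents (y.word ++ (z.word ++ m)) (write p [none] x) (() :: n)) s'
        (k + 8 * z.word.length + 8 * y.word.length) :=
      ihy (ihz (by simpa only [← write_append, Data.word] using! h))
    rw [Data.word, List.cons_append, List.append_assoc]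
    exact ((Runs.loop_step rfl ((runs_pop_main _).seq ((runs_emit p _ _ _ _).seq
      ((Runs.ite_true rfl ((runs_push_count _).seq (runs_push_count _))).seq
        (runs_pop_count _)))) hsubtrees).mono
          (by rw [List.length_cons, List.length_append]; omega))

/-- Moves one tree from `main` to the auxiliary stacks selected by `p`. -/
def read (p : Bool → Bool) : Program A :=
  load (fun _ => some none) ;; readLoop p

theorem runs_read (p : Bool → Bool) (t : Data A) (m x v) :
    Runs (read p) (v, contents (t.word ++ m) x [])
      (none, contents m (write p t.word x) []) (8 * t.word.length + 2) :=
  (Runs.load.seq (runs_readLoop p t (.loop_done rfl))).mono (by omega)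

/-- Moves the auxiliary stack `b` to `main`, reversing it. -/
def pour (b : Bool) : Program A :=
  pop (aux b) (fun _ s => s) ;;
    loop Option.isSome (push main (·.getD none) ;; pop (aux b) fun _ s => s)

theorem runs_pour (b : Bool) (v : Option (Option A)) (m x n) :
    Runs (pour b) (v, contents m x n)
      (none, contents ((x b).reverse ++ m) (update x b []) n) (3 * (x b).length + 2) := by
  have hloop (w : List (Option A)) (m) :
      Runs (loop Option.isSome (push main (·.getD none) ;; pop (aux b) fun _ s => s))
      (w.head?, contents m (update x b w.tail) n)
      (none, contents (w.reverse ++ m) (update x b []) n) (3 * w.length + 1) := by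
    induction w generalizing m with
    | nil => exact .loop_done rfl
    | cons s w ih =>
      have hbody := (runs_push_main (v := some s) (m := m) (x := update x b w) (n := n)
        (·.getD none)).seq (runs_pop_aux b fun _ s => s)
      simp only [update_self, update_idem] at hbody
      have hstep := Runs.loop_step (p := Option.isSome) rfl hbody (ih _)
      rw [List.reverse_cons, List.append_assoc]
      exact hstep.mono (by rw [List.length_cons]; omega)
  exact ((runs_pop_aux b _).seq (hloop (x b) m)).mono (by omega)

/-- `c` turns the content `w` of `main` into `w'` in at most `n` steps, if the other stacks are
empty. -/
def Transforms (c : Program A) (w w' : List (Option A)) (n : ℕ) : Prop :=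
  ∀ v, ∃ v', Runs c (v, single main w) (v', single main w') n

theorem Transforms.seq {c d : Program A} {w₁ w₂ w₃ : List (Option A)} {m n : ℕ}
    (hc : Transforms c w₁ w₂ m) (hd : Transforms d w₂ w₃ n) :
    Transforms (c ;; d) w₁ w₃ (m + n) := fun v =>
  let ⟨v', hv'⟩ := hc v
  let ⟨v'', hv''⟩ := hd v'
  ⟨v'', (hv'.seq hv'').mono (add_comm n m).le⟩

theorem Transforms.mono {c : Program A} {w w' : List (Option A)} {m n : ℕ}
    (h : Transforms c w w' m) (hmn : m ≤ n) : Transforms c w w' n := fun v =>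
  let ⟨v', hv'⟩ := h v
  ⟨v', hv'.mono hmn⟩

theorem transforms_load (f) (w : List (Option A)) : Transforms (load f) w w 1 :=
  fun v => ⟨f v, .load⟩

theorem transforms_push (s : Option A) (w : List (Option A)) :
    Transforms (push main fun _ => s) w (s :: w) 1 := fun v =>
  ⟨v, by simpa only [single_main] using runs_push_main fun _ => s⟩

theorem transforms_pop (s : Option A) (w : List (Option A)) :
    Transforms (pop main fun _ s => s) (s :: w) w 1 := fun v =>
  ⟨some s, by simpa only [single_main] using runs_pop_main fun _ s => s⟩

/-- Removes the tree on the top of `main`. -/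
def drop : Program A := read fun _ => false

theorem transforms_drop (t : Data A) (w : List (Option A)) :
    Transforms drop (t.word ++ w) w (8 * t.word.length + 2) := fun v =>
  ⟨none, by simpa only [single_main] using! runs_read (fun _ => false) t w (fun _ => []) v⟩

/-- Duplicates the tree on the top of `main`. -/
def dup : Program A := read (fun _ => true) ;; pour false ;; pour true

theorem transforms_dup (t : Data A) (w : List (Option A)) :
    Transforms dup (t.word ++ w) (t.word ++ (t.word ++ w)) (14 * t.word.length + 6) := fun v => by
  have h := (runs_read (fun _ => true) t w (fun _ => []) v).seq
    ((runs_pour false _ _ _ _).seq (runs_pour true _ _ _ _))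
  have haux : update (update (write (fun _ => true) t.word fun _ => []) false []) true [] =
      fun _ => [] := by
    funext b; cases b <;> rfl
  rw [haux] at h
  simp only [write, cond_true, ne_eq, Bool.true_eq_false, not_false_eq_true, update_of_ne,
    List.append_nil, List.reverse_reverse, List.length_reverse] at h
  exact ⟨none, by simpa only [single_main] using! h.mono (by omega)⟩

/-- Exchanges the two trees on the top of `main`. -/
def swap : Program A := read id ;; read not ;; pour true ;; pour false

theorem transforms_swap (t u : Data A) (w : List (Option A)) :
    Transforms swap (t.word ++ (u.word ++ w)) (u.word ++ (t.word ++ w))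
      (11 * (t.word.length + u.word.length) + 8) := fun v => by
  have h := (runs_read id t (u.word ++ w) (fun _ => []) v).seq
    ((runs_read not u w _ _).seq ((runs_pour true _ _ _ _).seq (runs_pour false _ _ _ _)))
  have haux (x : Bool → List (Option A)) : update (update x true []) false [] = fun _ => [] := by
    funext b; cases b <;> rfl
  rw [haux] at h
  simp only [ne_eq, Bool.false_eq_true, not_false_eq_true, update_of_ne, write, Bool.not_false, id,
    List.append_nil, cond_false, cond_true, List.reverse_reverse, Bool.not_true,
    List.length_reverse] at h
  exact ⟨none, by simpa only [single_main] using! h.mono (by omega)⟩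

theorem Transforms.runs_pop {c : Program A} {w w' : List (Option A)} {s : Option A} {n : ℕ}
    (h : Transforms c w (s :: w') n) (v : Option (Option A)) :
    Runs (c ;; pop main fun _ s => s) (v, single main w) (some s, single main w') (n + 1) := by
  obtain ⟨v', hv'⟩ := h v
  have hpop : Runs (Γ := Alphabet A) (pop main fun _ s => s) (v', single main (s :: w'))
      (some s, single main w') 1 := by
    simpa only [single_main] using runs_pop_main fun _ s => s
  exact (hv'.seq hpop).mono (add_comm 1 n).le

section Switch

variable {α : Type} [DecidableEq A] (leaf : α ↪ A) (c : α → Program A)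

/-- Continues with `c a` if the symbol in the register is the leaf of an element `a` of the
list. -/
def switch : List α → Program A
  | [] => load id
  | a :: l => ite (· == some (some (leaf a))) (c a) (switch l)

theorem runs_switch {a : α} {l : List α} (ha : a ∈ l) {S s' n}
    (h : Runs (c a) (some (some (leaf a)), S) s' n) :
    Runs (switch leaf c l) (some (some (leaf a)), S) s' (n + l.length) := by
  induction l with
  | nil => exact absurd ha List.not_mem_nil
  | cons b l ih =>
    obtain rfl | hab := eq_or_ne a b
    · exact (Runs.ite_true (by simp) h).mono (by simp)
    · exact (Runs.ite_false (by simpa using hab) (ih (List.mem_of_ne_of_mem hab ha))).mono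
        (by simp [add_assoc])

end Switch

/-- Runs `body` as long as `test`, which is to push a leaf onto `main`, pushes the leaf `a`. -/
def repeatWhile [DecidableEq A] (a : A) (test body : Program A) : Program A :=
  (test ;; pop main fun _ s => s) ;;
    loop (· == some (some a)) (body ;; test ;; pop main fun _ s => s)

theorem transforms_repeatWhile [DecidableEq A] {a : A} {test body : Program A}
    {w : ℕ → List (Option A)} {r : ℕ → A} {n p q : ℕ} (hr : ∀ i < n, r i = a) (hn : r n ≠ a)
    (htest : ∀ i ≤ n, Transforms test (w i) (some (r i) :: w i) p)
    (hbody : ∀ i < n, Transforms body (w i) (w (i + 1)) q) :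
    Transforms (repeatWhile a test body) (w 0) (w n) ((n + 1) * (p + q + 2)) := fun v => by
  have hloop : Runs (loop (· == some (some a)) (body ;; test ;; pop main fun _ s => s))
      (some (some (r 0)), single main (w 0)) (some (some (r n)), single main (w n))
      (n * (p + q + 2) + 1) := by
    induction n generalizing w r with
    | zero => exact (Runs.loop_done (by simpa using hn)).mono (by omega)
    | succ n ih =>
      obtain ⟨v', hv'⟩ := hbody 0 n.succ_pos (some (some (r 0)))
      have hloop := ih (w := fun i => w (i + 1)) (r := fun i => r (i + 1))
        (fun i hi => hr _ (Nat.succ_lt_succ hi)) hn (fun i hi => htest _ (Nat.succ_le_succ hi))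
        (fun i hi => hbody _ (Nat.succ_lt_succ hi))
      exact (Runs.loop_step (by simp [hr 0 n.succ_pos])
        (hv'.seq ((htest 1 (by omega)).runs_pop v')) hloop).mono (by rw [Nat.succ_mul]; omega)
  exact ⟨_, (((htest 0 n.zero_le).runs_pop v).seq hloop).mono (by rw [Nat.succ_mul]; omega)⟩

end DataStack

/-! ### Polynomial-time functions -/

/-- Types whose elements are written as trees with leaves in `A`. -/
class Coded (A α : Type) where
  code : α → Data A

/-- Types whose elements are written as single leaves. -/
class Atomic (A α : Type) where
  leaf : α ↪ A

namespace Coded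

variable {A : Type}

instance {α : Type} [Atomic A α] : Coded A α := ⟨fun a => .atom (Atomic.leaf a)⟩

instance {α β : Type} [Coded A α] [Coded A β] : Coded A (α × β) :=
  ⟨fun x => .pair (code x.1) (code x.2)⟩

instance [Inhabited A] {α : Type} [Coded A α] : Coded A (List α) :=
  ⟨List.foldr (fun a => .pair (code a)) (.atom default)⟩

variable (A) {α β : Type} [Coded A α] [Coded A β]

/-- The word of the tree of `a`. -/
def word (a : α) : List (Option A) := (code a : Data A).word

/-- The size of the tree of `a`. -/
def size (a : α) : ℕ := (word A a).length

theorem word_pair (a : α) (b : β) : word A (a, b) = none :: (word A a ++ word A b) := rfl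

theorem word_cons [Inhabited A] (a : α) (l : List α) :
    word A (a :: l) = none :: (word A a ++ word A l) := rfl

theorem size_pair (a : α) (b : β) : size A (a, b) = size A a + size A b + 1 := by
  simp only [size, word_pair, List.length_cons, List.length_append]

theorem size_nil [Inhabited A] : size A ([] : List α) = 1 := rfl

theorem size_cons [Inhabited A] (a : α) (l : List α) :
    size A (a :: l) = size A a + size A l + 1 := by
  simp only [size, word_cons, List.length_cons, List.length_append]

theorem size_atomic {α : Type} [Atomic A α] (a : α) : size A a = 1 := rfl

theorem size_le_of_mem [Inhabited A] {a : α} {l : List α} (ha : a ∈ l) : size A a ≤ size A l := by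
  induction l with
  | nil => exact absurd ha List.not_mem_nil
  | cons b l ih =>
    rw [size_cons]
    obtain rfl | ha := List.mem_cons.1 ha
    · omega
    · exact (ih ha).trans (by omega)

theorem size_drop_le [Inhabited A] (l : List α) (n : ℕ) : size A (l.drop n) ≤ size A l := by
  induction n generalizing l with
  | zero => exact le_rfl
  | succ n ih =>
    cases l with
    | nil => exact le_rfl
    | cons a l => exact (ih l).trans (by rw [size_cons]; omega)

theorem size_foldl_le {γ : Type} {f : β → γ → β} {l : List γ} {n : ℕ}
    (hf : ∀ b, ∀ a ∈ l, size A (f b a) ≤ size A b + n) (b : β) :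
    size A (l.foldl f b) ≤ size A b + l.length * n := by
  induction l generalizing b with
  | nil => exact Nat.le_add_right _ _
  | cons a l ih =>
    have h := hf b a List.mem_cons_self
    refine (ih (fun b a ha => hf b a (List.mem_cons_of_mem _ ha)) (f b a)).trans ?_
    rw [List.length_cons, Nat.succ_mul]
    omega

theorem length_le_size [Inhabited A] (l : List α) : l.length ≤ size A l := by
  induction l with
  | nil => exact Nat.zero_le _
  | cons a l ih => rw [size_cons, List.length_cons]; omega

end Coded

open Coded

section PolyBounded

variable {A α β : Type} [Coded A α] [Coded A β] {g h : α → ℕ}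

variable (A) in
/-- `g a` is bounded by a polynomial in the size of `a`. -/
def PolyBounded (g : α → ℕ) : Prop := ∃ p : Polynomial ℕ, ∀ a, g a ≤ p.eval (size A a)

namespace PolyBounded

theorem size : PolyBounded A (Coded.size A : α → ℕ) :=
  ⟨.X, fun _ => (Polynomial.eval_X).ge⟩

theorem const (n : ℕ) : PolyBounded A fun _ : α => n :=
  ⟨.C n, fun _ => (Polynomial.eval_C).ge⟩

theorem mono (hh : PolyBounded A h) (hgh : ∀ a, g a ≤ h a) : PolyBounded A g :=
  let ⟨p, hp⟩ := hh
  ⟨p, fun a => (hgh a).trans (hp a)⟩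

theorem add (hg : PolyBounded A g) (hh : PolyBounded A h) : PolyBounded A fun a => g a + h a :=
  let ⟨p, hp⟩ := hg
  let ⟨q, hq⟩ := hh
  ⟨p + q, fun a => by rw [Polynomial.eval_add]; exact add_le_add (hp a) (hq a)⟩

theorem mul (hg : PolyBounded A g) (hh : PolyBounded A h) : PolyBounded A fun a => g a * h a :=
  let ⟨p, hp⟩ := hg
  let ⟨q, hq⟩ := hh
  ⟨p * q, fun a => by rw [Polynomial.eval_mul]; exact Nat.mul_le_mul (hp a) (hq a)⟩

theorem mul_add_const (hg : PolyBounded A g) (m n : ℕ) : PolyBounded A fun a => m * g a + n :=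
  ((const m).mul hg).add (const n)

theorem sum {ι : Type} (s : Finset ι) {g : ι → α → ℕ} (hg : ∀ i, PolyBounded A (g i)) :
    PolyBounded A fun a => ∑ i ∈ s, g i a := by
  choose p hp using hg
  exact ⟨∑ i ∈ s, p i, fun a => by
    rw [Polynomial.eval_finsetSum]; exact Finset.sum_le_sum fun i _ => hp i a⟩

theorem monotone_eval (p : Polynomial ℕ) : Monotone fun n : ℕ => p.eval n := fun m n hmn => by
  simp only [Polynomial.eval_eq_sum_range]
  gcongr

theorem eval (p : Polynomial ℕ) (hg : PolyBounded A g) :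
    PolyBounded A fun a => p.eval (g a) :=
  let ⟨q, hq⟩ := hg
  ⟨p.comp q, fun a => by rw [Polynomial.eval_comp]; exact monotone_eval p (hq a)⟩

theorem comp {g : β → ℕ} (hg : PolyBounded A g) {f : α → β}
    (hf : PolyBounded A fun a => Coded.size A (f a)) : PolyBounded A fun a => g (f a) :=
  let ⟨p, hp⟩ := hg
  (hf.eval p).mono fun a => hp (f a)

theorem exists_of_size_le {g : β → ℕ} (hg : PolyBounded A g) :
    ∃ G : α → ℕ, PolyBounded A G ∧ ∀ a b, Coded.size A b ≤ Coded.size A a → g b ≤ G a :=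
  let ⟨p, hp⟩ := hg
  ⟨_, ⟨p, fun _ => le_rfl⟩, fun _ b hba => (hp b).trans (monotone_eval p hba)⟩

end PolyBounded

end PolyBounded

variable (A : Type) in
/-- `f` is computed in polynomial time by a program that transforms the tree of `a` on the top of
the stack `main` into the tree of `f a`. -/
def PolyTime {α β : Type} [Coded A α] [Coded A β] (f : α → β) : Prop :=
  ∃ (c : DataStack.Program A) (time : α → ℕ), PolyBounded A time ∧
    ∀ a w, DataStack.Transforms c (word A a ++ w) (word A (f a) ++ w) (time a)

namespace PolyTime

open StackProgram DataStack

variable {A α β γ δ : Type} [Coded A α] [Coded A β] [Coded A γ] [Coded A δ]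

theorem polyBounded_size {f : α → β} (hf : PolyTime A f) :
    PolyBounded A fun a => size A (f a) := by
  obtain ⟨c, time, htime, hc⟩ := hf
  refine (PolyBounded.size.add htime).mono fun a => ?_
  obtain ⟨v', hv'⟩ := hc a [] none
  simpa [single, size] using hv'.length_le main

theorem of_code_eq {f : α → β} (h : ∀ a, (code (f a) : Data A) = code a) : PolyTime A f :=
  ⟨load id, fun _ => 1, .const 1, fun a w => by
    rw [word, word, h]
    exact transforms_load _ _⟩

protected theorem id : PolyTime A (id : α → α) := of_code_eq fun _ => rfl

theorem of_eq {f g : α → β} (hf : PolyTime A f) (h : ∀ a, f a = g a) : PolyTime A g :=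
  (funext h : f = g) ▸ hf

theorem comp {f : β → γ} {g : α → β} (hf : PolyTime A f) (hg : PolyTime A g) :
    PolyTime A fun a => f (g a) :=
  let ⟨c, _, htime, hc⟩ := hf
  let ⟨d, _, htime', hd⟩ := hg
  ⟨d ;; c, _, htime'.add (htime.comp hg.polyBounded_size), fun a w => (hd a w).seq (hc (g a) w)⟩

theorem fst : PolyTime A (Prod.fst : α × β → α) := by
  refine ⟨pop main (fun _ s => s) ;; swap ;; drop, fun x => 19 * size A x + 11,
    PolyBounded.size.mul_add_const 19 11, fun x w => ?_⟩
  rw [word_pair, List.cons_append, List.append_assoc]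
  exact ((transforms_pop none _).seq ((transforms_swap _ _ _).seq (transforms_drop _ _))).mono
    (by simp only [size, word, code, Data.word, List.length_cons, List.length_append]; omega)

theorem snd : PolyTime A (Prod.snd : α × β → β) := by
  refine ⟨pop main (fun _ s => s) ;; drop, fun x => 8 * size A x + 3,
    PolyBounded.size.mul_add_const 8 3, fun x w => ?_⟩
  rw [word_pair, List.cons_append, List.append_assoc]
  exact ((transforms_pop none _).seq (transforms_drop _ _)).mono
    (by simp only [size, word, code, Data.word, List.length_cons, List.length_append]; omega)

theorem pair {f : α → β} {g : α → γ} (hf : PolyTime A f) (hg : PolyTime A g) :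
    PolyTime A fun a => (f a, g a) := by
  have hf' := hf.polyBounded_size
  have hg' := hg.polyBounded_size
  obtain ⟨c, time, htime, hc⟩ := hf
  obtain ⟨d, time', htime', hd⟩ := hg
  refine ⟨dup ;; c ;; swap ;; d ;; swap ;; push main fun _ => none,
    fun a => 14 * size A a + 6 + (time a + (11 * (size A (f a) + size A a) + 8 + (time' a +
      (11 * (size A (g a) + size A (f a)) + 8 + 1)))),
    (PolyBounded.size.mul_add_const 14 6).add (htime.add
      (((hf'.add .size).mul_add_const 11 8).add (htime'.add
        (((hg'.add hf').mul_add_const 11 8).add (.const 1))))),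
    fun a w => ?_⟩
  rw [word_pair, List.cons_append, List.append_assoc]
  exact (transforms_dup _ _).seq ((hc a _).seq ((transforms_swap _ _ _).seq ((hd a _).seq
    ((transforms_swap _ _ _).seq (transforms_push _ _)))))

theorem const (b : β) : PolyTime A fun _ : α => b := by
  have hpush (v : List (Option A)) :
      ∃ c : Program A, ∀ w, Transforms c w (v ++ w) (v.length + 1) := by
    induction v with
    | nil => exact ⟨load id, fun w => transforms_load _ w⟩
    | cons s v ih =>
      obtain ⟨c, hc⟩ := ih
      exact ⟨c ;; push main fun _ => s, fun w => (hc w).seq (transforms_push s _)⟩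
  obtain ⟨c, hc⟩ := hpush (word A b)
  exact ⟨drop ;; c, _, (PolyBounded.size.mul_add_const 8 2).add (.const _),
    fun a w => (transforms_drop _ _).seq (hc w)⟩

theorem cases {ι : Type} [Atomic A ι] [Finite ι] {f : ι → α → β} (hf : ∀ d, PolyTime A (f d)) :
    PolyTime A fun x : ι × α => f x.1 x.2 := by
  classical
  have := Fintype.ofFinite ι
  choose c time htime hc using hf
  refine ⟨(pop main (fun _ s => s) ;; pop main fun _ s => s) ;;
    switch Atomic.leaf c Finset.univ.toList,
    fun x => ∑ d, time d x.2 + Fintype.card ι + 2, ?_, fun ⟨d, a⟩ w v => ?_⟩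
  · exact ((PolyBounded.sum _ fun d => (htime d).comp snd.polyBounded_size).add (.const _)).add
      (.const 2)
  · obtain ⟨v', hv'⟩ := hc d a w (some (some (Atomic.leaf d)))
    have hswitch := runs_switch (Atomic.leaf (A := A)) c (Finset.mem_toList.2 (Finset.mem_univ d))
      hv'
    have hpop := (transforms_pop none (some (Atomic.leaf d) :: (word A a ++ w))).runs_pop v
    have hle : time d a ≤ ∑ d, time d a :=
      Finset.single_le_sum (fun d _ => Nat.zero_le (time d a)) (Finset.mem_univ d)
    have hlength : (Finset.univ.toList : List ι).length = Fintype.card ι :=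
      Finset.length_toList _
    exact ⟨v', (hpop.seq hswitch).mono (by dsimp only; omega)⟩

theorem of_finite {ι : Type} [Atomic A ι] [Finite ι] (f : ι → β) : PolyTime A f :=
  (cases fun d => const (f d)).comp (PolyTime.id.pair PolyTime.id)

theorem cond {p : α → Bool} {f g : α → β} [Atomic A Bool] (hp : PolyTime A p) (hf : PolyTime A f)
    (hg : PolyTime A g) : PolyTime A fun a => bif p a then f a else g a :=
  (cases (f := fun b a => bif b then f a else g a) fun b => by cases b <;> assumption).comp
    (hp.pair .id)

theorem not [Atomic A Bool] {p : α → Bool} (hp : PolyTime A p) :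
    PolyTime A fun a => !p a :=
  (of_finite Bool.not).comp hp

theorem and [Atomic A Bool] {p q : α → Bool} (hp : PolyTime A p)
    (hq : PolyTime A q) : PolyTime A fun a => p a && q a :=
  (hp.cond hq (const false)).of_eq fun a => by cases p a <;> rfl

theorem or [Atomic A Bool] {p q : α → Bool} (hp : PolyTime A p)
    (hq : PolyTime A q) : PolyTime A fun a => p a || q a :=
  (hp.cond (const true) hq).of_eq fun a => by cases p a <;> rfl

theorem listCases [Inhabited A] {f : α → β} {g : α → γ → List γ → β} {l : α → List γ}
    (hl : PolyTime A l) (hf : PolyTime A f)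
    (hg : PolyTime A fun x : (γ × List γ) × α => g x.2 x.1.1 x.1.2) :
    PolyTime A fun a => match l a with
      | [] => f a
      | c :: t => g a c t := by
  have hcases : PolyTime A fun x : List γ × α => match x.1 with
      | [] => f x.2
      | c :: t => g x.2 c t := by
    obtain ⟨c, time, htime, hc⟩ := hf
    obtain ⟨d, time', htime', hd⟩ := hg
    obtain ⟨time'', htime'', hle⟩ := htime'.exists_of_size_le (α := List γ × α)
    refine ⟨(pop main (fun _ s => s) ;; pop main fun _ s => s) ;;
      ite (· matches some none) (push main (fun _ => none) ;; push main (fun _ => none) ;; d) c,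
      fun x => 5 + time x.2 + time'' x, ((PolyBounded.const 5).add
      (htime.comp snd.polyBounded_size)).add htime'', fun ⟨l, a⟩ w v => ?_⟩
    cases l with
    | nil =>
      have hpop := (transforms_pop none (some default :: (word A a ++ w))).runs_pop v
      obtain ⟨v', hv'⟩ := hc a w (some (some default))
      exact ⟨v', (hpop.seq (.ite_false rfl hv')).mono (by simp only; omega)⟩
    | cons b l =>
      have hpop := (transforms_pop none
        (none :: (word A b ++ word A l ++ word A a ++ w))).runs_pop v
      obtain ⟨v', hv'⟩ := ((transforms_push none _).seq ((transforms_push none _).seq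
        (hd ((b, l), a) w))) (some none)
      have hsize := hle (b :: l, a) ((b, l), a) le_rfl
      exact ⟨v', (hpop.seq (.ite_true rfl hv')).mono (by simp only; omega)⟩
  exact hcases.comp (hl.pair .id)

theorem cons [Inhabited A] {f : α → β} {l : α → List β} (hf : PolyTime A f) (hl : PolyTime A l) :
    PolyTime A fun a => f a :: l a := hf.pair hl

theorem iterate [Atomic A Bool] {f : α → α} {p : α → Bool} {n g : α → ℕ} (hf : PolyTime A f)
    (hp : PolyTime A p) (hn : PolyBounded A n) (hg : PolyBounded A g)
    (hle : ∀ a, ∀ i ≤ n a, size A (f^[i] a) ≤ g a)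
    (htrue : ∀ a, ∀ i < n a, p (f^[i] a) = true) (hfalse : ∀ a, p (f^[n a] a) = false) :
    PolyTime A fun a => f^[n a] a := by
  classical
  obtain ⟨body, _, ⟨q, hq⟩, hbody⟩ := hf
  obtain ⟨test, _, ⟨r, hr⟩, htest⟩ := hp
  refine ⟨repeatWhile (Atomic.leaf true) (dup ;; test) body,
    fun a => (n a + 1) * (14 * g a + 6 + r.eval (g a) + q.eval (g a) + 2),
    (hn.add (.const 1)).mul ((((hg.mul_add_const 14 6).add (hg.eval r)).add (hg.eval q)).add
      (.const 2)), fun a w => ?_⟩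
  refine transforms_repeatWhile (w := fun i => word A (f^[i] a) ++ w)
    (r := fun i => Atomic.leaf (p (f^[i] a))) (fun i hi => congrArg _ (htrue a i hi))
    (fun h => ?_) (fun i hi => ?_) fun i hi => ?_
  · exact Bool.false_ne_true ((hfalse a).symm.trans (Atomic.leaf.injective h))
  · refine ((transforms_dup _ w).seq (htest (f^[i] a) _)).mono ?_
    have hdup := hle a i hi
    have htime := (hr (f^[i] a)).trans (PolyBounded.monotone_eval r (hle a i hi))
    simp only [size, word] at hdup htime ⊢
    omega
  · rw [Function.iterate_succ_apply']
    exact (hbody _ w).mono ((hq _).trans (PolyBounded.monotone_eval q (hle a i hi.le)))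

/-- One step of the iterative computation of `List.foldl`: the state consists of the parameter, the
accumulator and the remaining list. -/
def foldlStep (f : δ → β → α → β) (s : δ × β × List α) : δ × β × List α :=
  match s.2.2 with
  | [] => s
  | a :: t => (s.1, f s.1 s.2.1 a, t)

theorem iterate_foldlStep (f : δ → β → α → β) (d : δ) (b : β) (l : List α) (i : ℕ) :
    (foldlStep f)^[i] (d, b, l) = (d, (l.take i).foldl (f d) b, l.drop i) := by
  induction i generalizing b l with
  | zero => rfl
  | succ i ih =>
    cases l with
    | nil => exact (ih b []).trans (by simp only [List.take_nil, List.drop_nil])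
    | cons a l => exact ih (f d b a) l

theorem size_iterate_foldlStep_le [Inhabited A] {f : δ → β → α → β} {d : δ} {n : ℕ} {l : List α}
    (hf : ∀ b, ∀ a ∈ l, size A (f d b a) ≤ size A b + n) (b : β) {i : ℕ} (hi : i ≤ l.length) :
    size A ((foldlStep f)^[i] (d, b, l)) ≤ size A (d, b, l) + size A (d, b, l) * n := by
  have hfold := size_foldl_le (A := A) (f := f d) (l := l.take i)
    (fun b' a ha => hf b' a (List.mem_of_mem_take ha)) b
  have hdrop := size_drop_le (A := A) l i
  have hmul : i * n ≤ size A (d, b, l) * n :=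
    Nat.mul_le_mul_right _ (hi.trans ((length_le_size A l).trans
      (by simp only [size_pair]; omega)))
  rw [List.length_take_of_le hi] at hfold
  rw [iterate_foldlStep]
  simp only [size_pair] at hmul ⊢
  omega

/-- Since the growth in each step is bounded independently of the accumulator, all intermediate
results have polynomial size. -/
theorem foldl [Inhabited A] [Atomic A Bool] {f : δ → β → α → β} {l : δ → List α} {b : δ → β}
    {g : δ × α → ℕ} (hl : PolyTime A l) (hb : PolyTime A b)
    (hf : PolyTime A fun x : (δ × β) × α => f x.1.1 x.1.2 x.2) (hg : PolyBounded A g)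
    (hle : ∀ d b a, size A (f d b a) ≤ size A b + g (d, a)) :
    PolyTime A fun d => (l d).foldl (f d) (b d) := by
  let continues (s : δ × β × List α) : Bool := match s.2.2 with
    | [] => false
    | _ :: _ => true
  have hstep : PolyTime A (foldlStep f) :=
    listCases (snd.comp snd) .id (pair (fst.comp snd) (pair (hf.comp (pair
      (pair (fst.comp snd) (fst.comp (snd.comp snd))) (fst.comp fst))) (snd.comp fst)))
  have hcontinues : PolyTime A continues := listCases (snd.comp snd) (const false) (const true)
  obtain ⟨G, hG, hgG⟩ := hg.exists_of_size_le (α := δ × β × List α)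
  have hsize (s : δ × β × List α) (i : ℕ) (hi : i ≤ s.2.2.length) :
      size A ((foldlStep f)^[i] s) ≤ size A s + size A s * G s := by
    refine size_iterate_foldlStep_le (fun b a ha => (hle s.1 b a).trans
      (Nat.add_le_add_left (hgG s _ ?_) _)) s.2.1 hi
    have hsize_mem := size_le_of_mem (A := A) ha
    obtain ⟨d, b, l⟩ := s
    simp only [size_pair] at hsize_mem ⊢
    omega
  have hfoldl : PolyTime A fun s : δ × β × List α => (foldlStep f)^[s.2.2.length] s :=
    hstep.iterate hcontinues
      (PolyBounded.size.comp (snd.comp snd).polyBounded_size |>.mono fun s => length_le_size A _)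
      (PolyBounded.size.add (PolyBounded.size.mul hG)) hsize
      (fun ⟨d, b, l⟩ i hi => by
        rw [iterate_foldlStep]
        cases h : l.drop i with
        | nil => exact absurd (List.drop_eq_nil_iff.1 h) hi.not_ge
        | cons => simp only [continues])
      fun ⟨d, b, l⟩ => by rw [iterate_foldlStep, List.drop_length]
  exact ((fst.comp snd).comp (hfoldl.comp (PolyTime.id.pair (hb.pair hl)))).of_eq fun d => by
    rw [id, iterate_foldlStep, List.take_length]

end PolyTime

namespace Coded

theorem size_append {A α : Type} [Coded A α] [Inhabited A] (l l' : List α) :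
    size A (l ++ l') + 1 = size A l + size A l' := by
  induction l with
  | nil => rw [List.nil_append, size_nil, add_comm]
  | cons a l ih => rw [List.cons_append, size_cons, size_cons]; omega

theorem size_list_atomic {A α : Type} [Atomic A α] [Inhabited A] (l : List α) :
    size A l = 2 * l.length + 1 := by
  induction l with
  | nil => rfl
  | cons a l ih => rw [size_cons, size_atomic, ih, List.length_cons]; omega

section

variable {A α : Type} [Coded A α] [Inhabited A]

theorem size_modifyHead_le {f : α → α} {n : ℕ} (hf : ∀ a, size A (f a) ≤ size A a + n)
    (l : List α) : size A (l.modifyHead f) ≤ size A l + n := by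
  cases l with
  | nil => exact Nat.le_add_right _ _
  | cons a l =>
    have h := hf a
    rw [List.modifyHead_cons, size_cons, size_cons]
    omega

theorem size_filter_le (p : α → Bool) (l : List α) : size A (l.filter p) ≤ size A l := by
  induction l with
  | nil => exact le_rfl
  | cons a l ih =>
    rw [List.filter_cons, size_cons]
    split
    · rw [size_cons]; omega
    · omega

theorem size_map_le {f : α → α} (hf : ∀ a, size A (f a) ≤ size A a) (l : List α) :
    size A (l.map f) ≤ size A l := by
  induction l with
  | nil => exact le_rfl
  | cons a l ih =>
    have h := hf a
    rw [List.map_cons, size_cons, size_cons]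
    omega

end

end Coded

open Coded

namespace PolyTime

open StackProgram DataStack

variable {A α β γ δ : Type} [Coded A α] [Coded A β] [Coded A γ] [Coded A δ] [Inhabited A]

theorem isEmpty [Atomic A Bool] : PolyTime A (List.isEmpty : List α → Bool) :=
  (listCases (g := fun _ _ _ => false) .id (const true) (const false)).of_eq fun l => by
    cases l <;> rfl

theorem tail : PolyTime A (List.tail : List α → List α) :=
  (listCases (g := fun _ _ t => t) .id (const []) (snd.comp fst)).of_eq fun l => by
    cases l <;> rfl

theorem drop (n : ℕ) : PolyTime A (List.drop n : List α → List α) := by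
  induction n with
  | zero => exact .id
  | succ n ih => exact (ih.comp tail).of_eq fun l => by rw [List.drop_tail]

variable {l l' : δ → List α}

theorem modifyHead {f : δ → α → α} (hl : PolyTime A l)
    (hf : PolyTime A fun x : δ × α => f x.1 x.2) : PolyTime A fun d => (l d).modifyHead (f d) :=
  (listCases hl (const []) (g := fun d a t => f d a :: t)
    (cons (hf.comp (pair snd (fst.comp fst))) (snd.comp fst))).of_eq fun d => by
      cases l d <;> rfl

variable [Atomic A Bool]

theorem reverse (hl : PolyTime A l) : PolyTime A fun d => (l d).reverse := by
  refine (foldl (f := fun _ acc a => a :: acc) (g := fun x => 1 * size A x + 1) hl (const [])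
    (cons snd (snd.comp fst)) (PolyBounded.size.mul_add_const 1 1) fun d acc a => ?_).of_eq
    fun d => List.foldl_flip_cons_eq_append'.trans (List.append_nil _)
  rw [size_cons, size_pair]
  omega

theorem foldr {f : δ → α → β → β} {b : δ → β} {g : δ × α → ℕ} (hl : PolyTime A l)
    (hb : PolyTime A b) (hf : PolyTime A fun x : (δ × α) × β => f x.1.1 x.1.2 x.2)
    (hg : PolyBounded A g) (hle : ∀ d a b, size A (f d a b) ≤ size A b + g (d, a)) :
    PolyTime A fun d => (l d).foldr (f d) (b d) :=
  (foldl hl.reverse hb (f := fun d b a => f d a b)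
    (hf.comp (pair (pair (fst.comp fst) snd) (snd.comp fst))) hg fun _ b a => hle _ a b).of_eq
    fun _ => List.foldl_reverse

theorem map {f : δ → α → β} (hl : PolyTime A l) (hf : PolyTime A fun x : δ × α => f x.1 x.2) :
    PolyTime A fun d => (l d).map (f d) :=
  (foldr hl (const []) (f := fun d a l => f d a :: l) (cons (hf.comp fst) snd)
    (hf.polyBounded_size.add (.const 1)) fun d a l => by
      rw [size_cons, add_right_comm, add_comm]).of_eq
    fun d => List.map_eq_foldr.symm

theorem filter {p : δ → α → Bool} (hl : PolyTime A l)
    (hp : PolyTime A fun x : δ × α => p x.1 x.2) : PolyTime A fun d => (l d).filter (p d) := by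
  refine (foldr hl (const []) (f := fun d a l => bif p d a then a :: l else l)
    (cond (hp.comp fst) (cons (snd.comp fst) snd) snd)
    (g := fun x => 1 * size A x + 1) (PolyBounded.size.mul_add_const 1 1)
    fun d a l => ?_).of_eq fun d => (List.filter_eq_foldr (p d) (l d)).symm
  rw [size_pair]
  cases p d a
  · exact Nat.le_add_right _ _
  · rw [cond_true, size_cons]; omega

theorem append (hl : PolyTime A l) (hl' : PolyTime A l') : PolyTime A fun d => l d ++ l' d := by
  refine (foldr hl hl' (f := fun _ a l => a :: l) (cons (snd.comp fst) snd)
    (g := fun x => 1 * size A x + 1) (PolyBounded.size.mul_add_const 1 1) fun d a l => ?_).of_eq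
    fun d => List.foldr_cons_eq_append'
  rw [size_cons, size_pair]
  omega

theorem flatMap {f : δ → α → List β} (hl : PolyTime A l)
    (hf : PolyTime A fun x : δ × α => f x.1 x.2) : PolyTime A fun d => (l d).flatMap (f d) :=
  (foldr hl (const []) (f := fun d a l => f d a ++ l) (append (hf.comp fst) snd)
    hf.polyBounded_size fun d a l => by
      have h := size_append (A := A) (f d a) l
      dsimp only
      omega).of_eq
    fun d => by
      induction l d with
      | nil => rfl
      | cons a l ih => rw [List.foldr_cons, ih, List.flatMap_cons]

theorem flatten {l : δ → List (List α)} (hl : PolyTime A l) :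
    PolyTime A fun d => (l d).flatten :=
  (hl.flatMap (f := fun _ l => l) snd).of_eq fun _ => List.flatMap_id'

theorem any {p : δ → α → Bool} (hl : PolyTime A l)
    (hp : PolyTime A fun x : δ × α => p x.1 x.2) : PolyTime A fun d => (l d).any (p d) :=
  (isEmpty.comp (hl.filter hp)).not.of_eq fun d => by
    induction l d with
    | nil => rfl
    | cons a l ih => cases h : p d a <;> simp [h, ih]

theorem all {p : δ → α → Bool} (hl : PolyTime A l)
    (hp : PolyTime A fun x : δ × α => p x.1 x.2) : PolyTime A fun d => (l d).all (p d) :=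
  (hl.any (p := fun d a => !p d a) hp.not).not.of_eq fun _ => List.all_eq_not_any_not.symm

end PolyTime

/-- Equality of elements of `α` can be decided in polynomial time. -/
def PolyTimeEq (A α : Type) [Coded A α] [DecidableEq α] [Atomic A Bool] : Prop :=
  PolyTime A fun x : α × α => decide (x.1 = x.2)

namespace PolyTimeEq

open PolyTime

variable {A α β δ : Type} [Atomic A Bool]

theorem atomic [Atomic A α] [Finite α] [DecidableEq α] : PolyTimeEq A α :=
  cases fun a => of_finite fun b => decide (a = b)

variable [Coded A α] [Coded A β] [Coded A δ] [DecidableEq α] [DecidableEq β]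

theorem decide (h : PolyTimeEq A α) {f g : δ → α} (hf : PolyTime A f) (hg : PolyTime A g) :
    PolyTime A fun d => decide (f d = g d) :=
  PolyTime.comp (f := fun x : α × α => Decidable.decide (x.1 = x.2)) h (hf.pair hg)

theorem prod (hα : PolyTimeEq A α) (hβ : PolyTimeEq A β) : PolyTimeEq A (α × β) :=
  ((hα.decide (fst.comp fst) (fst.comp snd)).and
    (hβ.decide (snd.comp fst) (snd.comp snd))).of_eq fun x => by
      simp only [Prod.ext_iff, Bool.decide_and]

theorem of_injective (h : PolyTimeEq A β) {f : α → β} (hf : PolyTime A f)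
    (hinj : Function.Injective f) : PolyTimeEq A α :=
  (h.decide (hf.comp fst) (hf.comp snd)).of_eq fun _ => decide_eq_decide.2 hinj.eq_iff

theorem list [Inhabited A] (h : PolyTimeEq A α) : PolyTimeEq A (List α) := by
  let step (s : List α × Bool) (a : α) : List α × Bool := match s.1 with
    | [] => ([], false)
    | b :: l => (l, s.2 && Decidable.decide (a = b))
  have hstep : PolyTime A fun x : (List α × Bool) × α => step x.1 x.2 :=
    listCases (f := fun _ => ([], false))
      (g := fun x b l => (l, x.1.2 && Decidable.decide (x.2 = b)))
      (fst.comp fst) (const _) ((snd.comp fst).pair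
        ((snd.comp (fst.comp snd)).and (h.decide (snd.comp snd) (fst.comp fst))))
  have hsize (s : List α × Bool) (a : α) : size A (step s a) ≤ size A s + 0 := by
    obtain ⟨_ | ⟨b, l⟩, ok⟩ := s
    · exact le_rfl
    · simp only [step, size_pair, size_cons, size_atomic]; omega
  have hfoldl : PolyTime A fun x : List α × List α => x.1.foldl step (x.2, true) :=
    foldl (f := fun _ => step) (g := fun _ => 0) fst (snd.pair (const true))
      (hstep.comp (pair (snd.comp fst) snd)) (.const 0) fun _ => hsize
  have hcorrect (l l' : List α) (ok : Bool) :
      ((l.foldl step (l', ok)).2 && (l.foldl step (l', ok)).1.isEmpty) =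
        (ok && Decidable.decide (l = l')) := by
    induction l generalizing l' ok with
    | nil => cases l' <;> simp
    | cons a l ih =>
      cases l' with
      | nil => exact (ih [] false).trans (by simp)
      | cons b l' => exact (ih l' _).trans (by simp [Bool.and_assoc])
  exact ((snd.comp hfoldl).and (isEmpty.comp (fst.comp hfoldl))).of_eq fun x =>
    (hcorrect x.1 x.2 true).trans (Bool.true_and _)

theorem mem [Inhabited A] (h : PolyTimeEq A α) {a : δ → α} {l : δ → List α} (ha : PolyTime A a)
    (hl : PolyTime A l) : PolyTime A fun d => Decidable.decide (a d ∈ l d) :=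
  (hl.any (p := fun d b => Decidable.decide (b = a d)) (h.decide snd (ha.comp fst))).of_eq
    fun d => by simp [List.any_eq]

theorem dedup [Inhabited A] (h : PolyTimeEq A α) : PolyTime A (List.dedup : List α → List α) := by
  refine (foldr (f := fun _ a l => bif Decidable.decide (a ∈ l) then l else a :: l)
    (b := fun _ => []) (g := fun x => 1 * size A x + 1) .id (const [])
    ((h.mem (snd.comp fst) snd).cond snd (cons (snd.comp fst) snd))
    (PolyBounded.size.mul_add_const 1 1) fun l a l' => ?_).of_eq fun l => ?_
  · cases Decidable.decide (a ∈ l')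
    · rw [size_pair, cond_false, size_cons]; omega
    · exact Nat.le_add_right _ _
  · change l.foldr _ [] = l.dedup
    induction l with
    | nil => rfl
    | cons a l ih =>
      rw [List.foldr_cons, ih]
      by_cases h : a ∈ l <;> simp [h]

end PolyTimeEq

instance {A : Type} : Atomic A A := ⟨.refl A⟩

namespace DataStack

open Function StackProgram

variable {A : Type}

/-- Moves the word on `inp` to `main`, where it becomes the tree of the reversed word. -/
def loadInput [Inhabited A] : Program A :=
  push main (fun _ => some default) ;; pop inp (fun _ s => s.map some) ;;
    loop Option.isSome
      (push main (·.getD none) ;; push main (fun _ => none) ;; pop inp fun _ s => s.map some)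

theorem runs_loadInput [Inhabited A] (w : List A) (v : Option (Option A)) :
    Runs loadInput (v, single inp w) (none, single main (Coded.word A w.reverse))
      (4 * w.length + 3) := by
  let S (w : List A) (m : List (Option A)) (k) : List (Alphabet A k) :=
    update (single main m) inp w k
  have hpush (v w m) (f : Option (Option A) → Option A) :
      Runs (push main f) (v, S w m) (v, S w (f v :: m)) 1 := by
    have hS : S w (f v :: m) = update (S w m) main (f v :: m) := by funext k; cases k <;> rfl
    rw [hS]
    exact .push
  have hpop (v w m) : Runs (pop inp fun _ s => s.map some) (v, S w m)
      (w.head?.map some, S w.tail m) 1 := by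
    have hS : S w.tail m = update (S w m) inp w.tail := by funext k; cases k <;> rfl
    rw [hS]
    exact .pop
  have hloop (w w' : List A) :
      Runs (loop Option.isSome
        (push main (·.getD none) ;; push main (fun _ => none) ;; pop inp fun _ s => s.map some))
      (w.head?.map some, S w.tail (Coded.word A w'))
      (none, S [] (Coded.word A (w.reverse ++ w'))) (4 * w.length + 1) := by
    induction w generalizing w' with
    | nil => exact .loop_done rfl
    | cons a w ih =>
      rw [List.reverse_cons, List.append_assoc]
      exact (Runs.loop_step rfl ((hpush _ _ _ _).seq ((hpush _ _ _ _).seq (hpop _ _ _)))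
        (ih (a :: w'))).mono (by rw [List.length_cons]; omega)
  have hstart : S w [] = single inp w := by
    funext k; cases k <;> rfl
  have hend (m) : S [] m = single main m := by
    funext k; cases k <;> rfl
  have h := (hpush v w [] fun _ => some default).seq ((hpop _ _ _).seq (hloop w []))
  rw [hstart, hend, List.append_nil] at h
  exact h

end DataStack

namespace PolyTime

open StackProgram DataStack

variable {A : Type} [Inhabited A] [Atomic A Bool]

theorem nonempty_tm2ComputableInPolyTime [Finite A] {g : List A → Bool} (hg : PolyTime A g)
    {α : Type} (encode : α → List A) :
    Nonempty (Turing.TM2ComputableInPolyTime encode Computability.encodeBool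
      fun a => g (encode a)) := by
  classical
  obtain ⟨c, time, ⟨p, hp⟩, hc⟩ := hg.comp (reverse .id)
  let isTrue (s : Option (Option A)) : Bool := decide (s = some (some (Atomic.leaf true)))
  have (k : DataStack) : Finite (Alphabet A k) := by cases k <;> infer_instance
  refine tm2ComputableInPolyTime (inp := inp) (out := out)
    (loadInput ;; (c ;; pop main fun _ s => s) ;;
      push out isTrue) none
    (.C 5 + .C 4 * .X + p.comp (.C 2 * .X + .C 1)) fun a => ?_
  let reg : Option (Option A) := some (some (Atomic.leaf (g (encode a))))
  have hload := runs_loadInput (encode a) none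
  have hrun := ((hc (encode a).reverse []).mono (hp _)).runs_pop none
  have hpush : Runs (Γ := Alphabet A) (push out isTrue) (reg, single main [])
      (reg, single out [g (encode a)]) 1 := by
    have hout : single (Γ := Alphabet A) out [g (encode a)] =
        Function.update (single main []) out [isTrue reg] := by
      funext k
      cases k with
      | out => simp [single, isTrue, reg]
      | _ => rfl
    rw [hout]
    exact .push
  rw [size_list_atomic, List.length_reverse] at hrun
  simp only [id, List.reverse_reverse, List.append_nil] at hrun
  refine ⟨_, (hload.seq (hrun.seq hpush)).mono ?_⟩
  simp only [Polynomial.eval_add, Polynomial.eval_mul, Polynomial.eval_comp, Polynomial.eval_C,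
    Polynomial.eval_X]
  omega

end PolyTime

/-! ### Strong backdoors and deletion of variables -/

namespace DefaultLogic

namespace DefaultTheory

/-- The clauses occurring in the theory. -/
def clauses (T : DefaultTheory) : Set Clause := {C | ∃ φ ∈ T.formulas, C ∈ φ}

theorem mem_formulas {T : DefaultTheory} {φ : CNF} :
    φ ∈ T.formulas ↔ φ ∈ T.W ∨ ∃ d ∈ T.D, φ = d.prereq ∨ φ = d.just ∨ φ = d.concl := by
  simp [formulas]

theorem isIn_setOf_iff {T : DefaultTheory} {Good : Clause → Prop} :
    T.IsIn {φ | ∀ C ∈ φ, Good C} ↔ ∀ C ∈ T.clauses, Good C := by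
  simp only [IsIn, clauses, mem_formulas, Set.mem_ofPred_eq]
  constructor
  · rintro ⟨h₁, h₂⟩ C ⟨φ, hφ | ⟨d, hd, rfl | rfl | rfl⟩, hC⟩
    · exact h₁ φ hφ C hC
    · exact (h₂ d hd).1 C hC
    · exact (h₂ d hd).2.1 C hC
    · exact (h₂ d hd).2.2 C hC
  · intro h
    refine ⟨fun φ hφ C hC => h C ⟨φ, .inl hφ, hC⟩, fun d hd => ⟨fun C hC => ?_, fun C hC => ?_,
      fun C hC => ?_⟩⟩
    · exact h C ⟨_, .inr ⟨d, hd, .inl rfl⟩, hC⟩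
    · exact h C ⟨_, .inr ⟨d, hd, .inr (.inl rfl)⟩, hC⟩
    · exact h C ⟨_, .inr ⟨d, hd, .inr (.inr rfl)⟩, hC⟩

theorem mem_vars_of_mem_clauses {T : DefaultTheory} {C : Clause} (hC : C ∈ T.clauses) {l : Lit}
    (hl : l ∈ C) : l.var ∈ T.vars := by
  obtain ⟨φ, hφ, hC⟩ := hC
  simp only [vars, CNF.vars, Finset.mem_biUnion, Finset.mem_image]
  exact ⟨φ, hφ, C, hC, l, hl, rfl⟩

theorem exists_mem_formulas_reduct {T : DefaultTheory} (y : ℕ → Var) (e : ExtLit) {φ : CNF}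
    (hφ : φ ∈ T.formulas) : ∃ ψ ∈ (T.reduct y e).formulas, φ.reduct e ⊆ ψ := by
  rw [mem_formulas] at hφ
  simp only [mem_formulas, reduct, Finset.mem_singleton]
  rcases hφ with hφ | ⟨d, hd, h⟩
  · exact ⟨_, .inl rfl, fun C hC => Finset.mem_biUnion.2 ⟨φ, hφ, hC⟩⟩
  · obtain ⟨i, hi, rfl⟩ := List.getElem_of_mem hd
    rcases h with rfl | rfl | rfl
    · exact ⟨_, .inr ⟨_, List.mem_mapIdx.2 ⟨i, hi, rfl⟩, .inl rfl⟩, subset_rfl⟩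
    · exact ⟨_, .inr ⟨_, List.mem_mapIdx.2 ⟨i, hi, rfl⟩, .inr (.inl rfl)⟩, subset_rfl⟩
    · exact ⟨_, .inr ⟨_, List.mem_mapIdx.2 ⟨i, hi, rfl⟩, .inr (.inr rfl)⟩,
        Finset.subset_insert _ _⟩

theorem exists_of_mem_clauses_reduct {T : DefaultTheory} {y : ℕ → Var} {e : ExtLit} {D : Clause}
    (hD : D ∈ (T.reduct y e).clauses) :
    (∃ i, D = {⟨y i, true⟩}) ∨ ∃ φ ∈ T.formulas, D ∈ φ.reduct e := by
  obtain ⟨ψ, hψ, hD⟩ := hD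
  simp only [mem_formulas, reduct, Finset.mem_singleton] at hψ ⊢
  rcases hψ with rfl | ⟨d, hd, h⟩
  · obtain ⟨φ, hφ, hD⟩ := Finset.mem_biUnion.1 hD
    exact .inr ⟨φ, .inl hφ, hD⟩
  · obtain ⟨i, hi, rfl⟩ := List.mem_mapIdx.1 hd
    rcases h with rfl | rfl | rfl
    · exact .inr ⟨_, .inr ⟨_, List.getElem_mem hi, .inl rfl⟩, hD⟩
    · exact .inr ⟨_, .inr ⟨_, List.getElem_mem hi, .inr (.inl rfl)⟩, hD⟩
    · rcases Finset.mem_insert.1 hD with h | h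
      · exact .inl ⟨i, h⟩
      · exact .inr ⟨_, .inr ⟨_, List.getElem_mem hi, .inr (.inr rfl)⟩, h⟩

end DefaultTheory

theorem Lit.var_eq_iff {l l' : Lit} : l.var = l'.var ↔ l = l' ∨ l = l'.neg := by
  obtain ⟨x, b⟩ := l
  obtain ⟨x', b'⟩ := l'
  cases b <;> cases b' <;> simp [Lit.neg]

theorem CNF.exists_subset_of_mem_reduct {φ : CNF} {e : ExtLit} {D : Clause}
    (hD : D ∈ φ.reduct e) : ∃ C ∈ φ, D ⊆ C.filter fun l => l.var ≠ e.var := by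
  cases e with
  | lit l =>
    simp only [CNF.reduct, Finset.mem_image, Finset.mem_filter] at hD
    obtain ⟨C, ⟨hC, hl⟩, rfl⟩ := hD
    refine ⟨C, hC, fun l' hl' => ?_⟩
    rw [Finset.mem_erase] at hl'
    refine Finset.mem_filter.2 ⟨hl'.2, fun h => ?_⟩
    rcases Lit.var_eq_iff.1 h with rfl | rfl
    · exact hl hl'.2
    · exact hl'.1 rfl
  | eps x =>
    simp only [CNF.reduct, Finset.mem_image] at hD
    obtain ⟨C, hC, rfl⟩ := hD
    exact ⟨C, hC, subset_rfl⟩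

namespace DefaultTheory

theorem filter_mem_clauses_reducts (y : ℕ → Var) (L : List Var) {T : DefaultTheory} {C : Clause}
    (hC : C ∈ T.clauses) :
    (C.filter fun l => l.var ∉ L) ∈ (T.reducts y (L.map .eps)).clauses := by
  induction L generalizing T C with
  | nil => simpa [reducts] using hC
  | cons x L ih =>
    have h : (C.filter fun l => l.var ≠ x) ∈ (T.reduct y (.eps x)).clauses := by
      obtain ⟨φ, hφ, hC⟩ := hC
      obtain ⟨ψ, hψ, h⟩ := exists_mem_formulas_reduct y (.eps x) hφ
      exact ⟨ψ, hψ, h (Finset.mem_image_of_mem _ hC)⟩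
    have := ih h
    rw [Finset.filter_filter] at this
    simpa [reducts, and_comm] using this

theorem exists_of_mem_clauses_reducts {y : ℕ → Var} {Y : List ExtLit} {T : DefaultTheory}
    {D : Clause} (hD : D ∈ (T.reducts y Y).clauses) :
    (∃ i, D ⊆ {⟨y i, true⟩}) ∨
      ∃ C ∈ T.clauses, D ⊆ C.filter fun l => l.var ∉ Y.map ExtLit.var := by
  induction Y generalizing T with
  | nil => exact .inr ⟨D, hD, by simp⟩
  | cons e Y ih =>
    rcases ih (T := T.reduct y e) hD with h | ⟨C, hC, h⟩
    · exact .inl h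
    rcases exists_of_mem_clauses_reduct hC with ⟨i, rfl⟩ | ⟨φ, hφ, hC⟩
    · exact .inl ⟨i, h.trans (Finset.filter_subset _ _)⟩
    · obtain ⟨C', hC', h'⟩ := CNF.exists_subset_of_mem_reduct hC
      refine .inr ⟨C', ⟨φ, hφ, hC'⟩, fun l hl => ?_⟩
      have h₁ := Finset.mem_filter.1 (h hl)
      have h₂ := Finset.mem_filter.1 (h' h₁.1)
      simp only [List.map_cons, List.mem_cons, not_or, Finset.mem_filter]
      exact ⟨h₂.1, h₂.2, h₁.2⟩

end DefaultTheory

theorem isThreefold_eps (B : Finset Var) : IsThreefold B (B.toList.map .eps) := by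
  have h : (B.toList.map ExtLit.eps).map ExtLit.var = B.toList := by
    rw [List.map_map]; exact List.map_id _
  rw [IsThreefold, h]
  exact ⟨B.nodup_toList, by simp⟩

theorem exists_fresh (V : Finset Var) : ∃ y : ℕ → Var, Function.Injective y ∧ ∀ i, y i ∉ V := by
  have : Infinite {x : Var // x ∉ V} := (Finset.finite_toSet V).infinite_compl.to_subtype
  let f := Infinite.natEmbedding {x : Var // x ∉ V}
  exact ⟨fun i => (f i).1, Subtype.val_injective.comp f.injective, fun i => (f i).2⟩

theorem isStrongBackdoor_setOf_iff {Good : Clause → Prop} (hmono : ∀ C D, C ⊆ D → Good D → Good C)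
    (hunit : ∀ x, Good {⟨x, true⟩}) (T : DefaultTheory) (B : Finset Var) :
    IsStrongBackdoor {φ | ∀ C ∈ φ, Good C} T B ↔
      B ⊆ T.vars ∧ ∀ C ∈ T.clauses, Good (C.filter fun l => l.var ∉ B) := by
  refine and_congr_right fun _ => ⟨fun h C hC => ?_, fun h y _ _ Y hY => ?_⟩
  · obtain ⟨y, hy, hy'⟩ := exists_fresh T.vars
    have := DefaultTheory.isIn_setOf_iff.1 (h y hy hy' _ (isThreefold_eps B)) _
      (DefaultTheory.filter_mem_clauses_reducts y B.toList hC)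
    simpa using this
  · refine DefaultTheory.isIn_setOf_iff.2 fun D hD => ?_
    rcases DefaultTheory.exists_of_mem_clauses_reducts hD with ⟨i, hi⟩ | ⟨C, hC, hD⟩
    · exact hmono _ _ hi (hunit _)
    · refine hmono _ _ hD ?_
      convert h C hC using 5
      rw [← hY.2, List.mem_toFinset]

theorem isStrongBackdoor_horn_iff (T : DefaultTheory) (B : Finset Var) (hB : B ⊆ T.vars) :
    IsStrongBackdoor Horn T B ↔ (hornGraph T).IsVertexCover (B : Set Var) := by
  refine (isStrongBackdoor_setOf_iff (fun C D h hD =>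
    (Finset.card_le_card (Finset.filter_subset_filter _ h)).trans hD)
    (fun x => (Finset.card_filter_le _ _)) T B).trans ?_
  simp only [hB, true_and, Finset.card_le_one, Finset.mem_filter]
  constructor
  · rintro h x z ⟨hne, φ, hφ, C, hC, hx, hz⟩
    by_contra! hn
    exact hne (congrArg Lit.var (h C ⟨φ, hφ, hC⟩ ⟨x, true⟩ ⟨⟨hx, hn.1⟩, rfl⟩ ⟨z, true⟩
      ⟨⟨hz, hn.2⟩, rfl⟩))
  · rintro h C ⟨φ, hφ, hC⟩ ⟨x, _⟩ ⟨⟨hx, hxB⟩, rfl⟩ ⟨z, _⟩ ⟨⟨hz, hzB⟩, rfl⟩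
    by_contra hne
    rcases h (v := x) (w := z) ⟨fun h => hne (by rw [h]), φ, hφ, C, hC, hx, hz⟩ with h | h
    · exact hxB h
    · exact hzB h

theorem isStrongBackdoor_posUnit_iff (T : DefaultTheory) (B : Finset Var) (hB : B ⊆ T.vars) :
    IsStrongBackdoor PosUnit T B ↔
      (primalGraph T).IsVertexCover (B : Set Var) ∧ negVars T ⊆ (B : Set Var) := by
  refine (isStrongBackdoor_setOf_iff (Good := fun C => C.card ≤ 1 ∧ ∀ l ∈ C, l.pos = true)
    (fun C D h hD => ⟨(Finset.card_le_card h).trans hD.1, fun l hl => hD.2 l (h hl)⟩)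
    (fun x => by simp) T B).trans ?_
  simp only [hB, true_and, Finset.card_le_one, Finset.mem_filter]
  constructor
  · refine fun h => ⟨?_, ?_⟩
    · rintro x z ⟨hne, φ, hφ, C, hC, hx, hz⟩
      obtain ⟨l, hl, rfl⟩ := Finset.mem_image.1 hx
      obtain ⟨l', hl', rfl⟩ := Finset.mem_image.1 hz
      by_contra! hn
      exact hne (congrArg Lit.var ((h C ⟨φ, hφ, hC⟩).1 l ⟨hl, hn.1⟩ l' ⟨hl', hn.2⟩))
    · rintro x ⟨φ, hφ, C, hC, hx⟩
      by_contra hn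
      exact absurd ((h C ⟨φ, hφ, hC⟩).2 ⟨x, false⟩ ⟨hx, hn⟩) (by simp)
  · rintro ⟨h, hneg⟩ C ⟨φ, hφ, hC⟩
    have hpos : ∀ l : Lit, l ∈ C ∧ l.var ∉ B → l.pos = true := by
      rintro ⟨x, _ | _⟩ ⟨hl, hlB⟩
      · exact absurd (hneg ⟨φ, hφ, C, hC, hl⟩) hlB
      · rfl
    refine ⟨fun l hl l' hl' => ?_, hpos⟩
    by_contra hne
    have hne' : l.var ≠ l'.var := fun hv => by
      have h₁ := hpos l hl
      have h₂ := hpos l' hl'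
      obtain ⟨x, b⟩ := l
      obtain ⟨x', b'⟩ := l'
      simp_all
    rcases h (v := l.var) (w := l'.var) ⟨hne', φ, hφ, C, hC, Finset.mem_image_of_mem _ hl.1,
      Finset.mem_image_of_mem _ hl'.1⟩ with h | h
    · exact hl.2 h
    · exact hl'.2 h

theorem isStrongBackdoor_krom_iff (T : DefaultTheory) (B : Finset Var) (hB : B ⊆ T.vars)
    (hT : T.TautologyFree) :
    IsStrongBackdoor Krom T B ↔ IsHittingSet (kromHypergraph T) B := by
  refine (isStrongBackdoor_setOf_iff (fun C D h hD => (Finset.card_le_card h).trans hD)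
    (fun x => by simp) T B).trans ?_
  simp only [hB, true_and]
  constructor
  · rintro h e ⟨he, φ, hφ, C, hC, heC⟩
    by_contra hn
    rw [Finset.not_nonempty_iff_eq_empty, ← Finset.disjoint_iff_inter_eq_empty] at hn
    have h₁ : e ⊆ (C.filter fun l => l.var ∉ B).image Lit.var := fun x hx => by
      obtain ⟨l, hl, rfl⟩ := Finset.mem_image.1 (heC hx)
      exact Finset.mem_image_of_mem _ (Finset.mem_filter.2 ⟨hl, Finset.disjoint_left.1 hn hx⟩)
    have h₂ := (Finset.card_le_card h₁).trans Finset.card_image_le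
    have h₃ := h C ⟨φ, hφ, hC⟩
    omega
  · rintro h C ⟨φ, hφ, hC⟩
    by_contra! hn
    obtain ⟨D, hD, hD3⟩ := Finset.exists_subset_card_eq hn
    have hDC : ∀ l ∈ D, l ∈ C := fun l hl => (Finset.mem_filter.1 (hD hl)).1
    have hinj : Set.InjOn Lit.var (D : Set Lit) := fun l hl l' hl' hv => by
      rcases Lit.var_eq_iff.1 hv with h | rfl
      · exact h
      · exact absurd (hDC _ hl) (hT φ hφ C hC _ (hDC _ hl'))
    obtain ⟨x, hx⟩ := h (D.image Lit.var) ⟨by rw [Finset.card_image_of_injOn hinj, hD3], φ, hφ, C,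
      hC, Finset.image_subset_image hDC⟩
    obtain ⟨hx, hxB⟩ := Finset.mem_inter.1 hx
    obtain ⟨l, hl, rfl⟩ := Finset.mem_image.1 hx
    exact (Finset.mem_filter.1 (hD hl)).2 hxB

theorem isStrongBackdoor_monotone_iff (T : DefaultTheory) (B : Finset Var) (hB : B ⊆ T.vars) :
    IsStrongBackdoor Monotone T B ↔ negVars T ⊆ (B : Set Var) := by
  refine (isStrongBackdoor_setOf_iff (Good := fun C => ∀ l ∈ C, l.pos = true)
    (fun C D h hD l hl => hD l (h hl)) (fun x => by simp) T B).trans ?_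
  simp only [hB, true_and, Finset.mem_filter]
  constructor
  · rintro h x ⟨φ, hφ, C, hC, hx⟩
    by_contra hn
    exact absurd (h C ⟨φ, hφ, hC⟩ ⟨x, false⟩ ⟨hx, hn⟩) (by simp)
  · rintro h C ⟨φ, hφ, hC⟩ ⟨x, _ | _⟩ ⟨hl, hlB⟩
    · exact absurd (h ⟨φ, hφ, C, hC, hl⟩) hlB
    · rfl

/-- The clauses of weight less than `thr`, where a literal of sign `b` has the weight `wt b`. -/
def Light (wt : Bool → ℕ) (thr : ℕ) (C : Clause) : Prop := ∑ l ∈ C, wt l.pos < thr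

theorem Light.mono {wt : Bool → ℕ} {thr : ℕ} {C D : Clause} (h : C ⊆ D) (hD : Light wt thr D) :
    Light wt thr C :=
  (Finset.sum_le_sum_of_subset h).trans_lt hD

/-- `Θ` consists of the formulas whose clauses are all light, positive unit clauses among them. -/
structure IsWeighting (wt : Bool → ℕ) (thr : ℕ) (Θ : Set CNF) : Prop where
  unit_lt : wt true < thr
  eq_setOf : Θ = {φ | ∀ C ∈ φ, Light wt thr C}

theorem isWeighting_horn : IsWeighting (fun b => if b then 1 else 0) 2 Horn where
  unit_lt := by decide
  eq_setOf := Set.ext fun φ => forall₂_congr fun C _ => by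
    rw [Light, Finset.card_filter, Nat.lt_succ_iff]

theorem isWeighting_krom : IsWeighting (fun _ => 1) 3 Krom where
  unit_lt := by decide
  eq_setOf := Set.ext fun φ => forall₂_congr fun C _ => by
    rw [Light, ← Finset.card_eq_sum_ones, Nat.lt_succ_iff]

theorem isWeighting_monotone : IsWeighting (fun b => if b then 0 else 1) 1 Monotone where
  unit_lt := by decide
  eq_setOf := Set.ext fun φ => forall₂_congr fun C _ => by simp [Light]

theorem isWeighting_posUnit : IsWeighting (fun b => if b then 1 else 2) 2 PosUnit where
  unit_lt := by decide
  eq_setOf := Set.ext fun φ => forall₂_congr fun C _ => by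
    constructor
    · rintro ⟨hcard, hpos⟩
      rw [Light, Finset.sum_congr rfl (g := fun _ => 1) fun l hl => if_pos (hpos l hl),
        ← Finset.card_eq_sum_ones]
      exact Nat.lt_succ_of_le hcard
    · intro h
      have hcard : C.card ≤ ∑ l ∈ C, if l.pos = true then 1 else 2 := by
        rw [Finset.card_eq_sum_ones]
        exact Finset.sum_le_sum fun l _ => by split <;> decide
      refine ⟨Nat.le_of_lt_succ (hcard.trans_lt h), fun l hl => by_contra fun hneg => ?_⟩
      have hle := Finset.single_le_sum (f := fun l : Lit => if l.pos = true then 1 else 2)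
        (fun _ _ => Nat.zero_le _) hl
      rw [if_neg hneg] at hle
      exact hle.not_gt h

theorem exists_isWeighting {Θ : Set CNF}
    (hΘ : Θ ∈ ({Horn, PosUnit, Krom, Monotone} : Set (Set CNF))) :
    ∃ wt thr, IsWeighting wt thr Θ := by
  obtain rfl | rfl | rfl | rfl := hΘ
  exacts [⟨_, _, isWeighting_horn⟩, ⟨_, _, isWeighting_posUnit⟩, ⟨_, _, isWeighting_krom⟩,
    ⟨_, _, isWeighting_monotone⟩]

variable {wt : Bool → ℕ} {thr : ℕ} {Θ : Set CNF}

theorem IsWeighting.isStrongBackdoor_iff (h : IsWeighting wt thr Θ) (T : DefaultTheory)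
    (B : Finset Var) :
    IsStrongBackdoor Θ T B ↔
      B ⊆ T.vars ∧ ∀ C ∈ T.clauses, Light wt thr (C.filter fun l => l.var ∉ B) := by
  rw [h.eq_setOf]
  exact isStrongBackdoor_setOf_iff (fun C D hCD hD => hD.mono hCD)
    (fun x => by simpa [Light] using h.unit_lt) T B

theorem IsWeighting.exists_isStrongBackdoor_iff (h : IsWeighting wt thr Θ) (T : DefaultTheory)
    (k : ℕ) :
    (∃ B, IsStrongBackdoor Θ T B ∧ B.card ≤ k) ↔
      ∃ B : Finset Var, B.card ≤ k ∧
        ∀ C ∈ T.clauses, Light wt thr (C.filter fun l => l.var ∉ B) := by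
  simp only [h.isStrongBackdoor_iff]
  refine ⟨fun ⟨B, ⟨_, hB⟩, hk⟩ => ⟨B, hk, hB⟩, fun ⟨B, hk, hB⟩ => ⟨B ∩ T.vars,
    ⟨Finset.inter_subset_right, fun C hC => (hB C hC).mono fun l hl => ?_⟩,
    (Finset.card_le_card Finset.inter_subset_left).trans hk⟩⟩
  obtain ⟨hl, hlB⟩ := Finset.mem_filter.1 hl
  exact Finset.mem_filter.2 ⟨hl, fun h =>
    hlB (Finset.mem_inter.2 ⟨h, DefaultTheory.mem_vars_of_mem_clauses hC hl⟩)⟩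

end DefaultLogic

/-! ### The search tree -/

namespace DefaultLogic

section Search

variable (wt : Bool → ℕ) (thr : ℕ)

/-- The weight of a list of literals, counted with multiplicity. -/
def weight (c : List Lit) : ℕ := (c.map fun l => wt l.pos).sum

/-- The literals of a clause that contribute to its weight, without repetitions. -/
def normalize (c : List Lit) : List Lit := c.dedup.filter fun l => decide (0 < wt l.pos)

/-- The literals of the heavy clauses. If there are any and all weights are positive, then every
solution contains the variable of one of the first `thr` candidates. -/
def candidates (cs : List (List Lit)) : List Lit :=
  (cs.filter fun c => decide (thr ≤ weight wt c)).flatten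

/-- The deletion of the variable of the `i`-th candidate, if there is one. -/
def branch (i : ℕ) (cs : List (List Lit)) : List (List Lit) :=
  match (candidates wt thr cs).drop i with
  | [] => cs
  | a :: _ => cs.map fun c => c.filter fun l => decide (l.var ≠ a.var)

/-- All clauses are light. -/
def isSolved (cs : List (List Lit)) : Bool := cs.all fun c => !decide (thr ≤ weight wt c)

end Search

variable {wt : Bool → ℕ} {thr : ℕ}

theorem weight_mono {c d : List Lit} (h : c.Sublist d) : weight wt c ≤ weight wt d :=
  (h.map _).sum_le_sum fun _ _ => Nat.zero_le _

theorem length_le_weight {c : List Lit} (hc : ∀ l ∈ c, 0 < wt l.pos) : c.length ≤ weight wt c := by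
  have h := List.card_nsmul_le_sum (c.map fun l => wt l.pos) 1 fun n hn => by
    obtain ⟨l, hl, rfl⟩ := List.mem_map.1 hn
    exact hc l hl
  simpa [weight] using h

theorem le_weight_take {c : List Lit} (hc : ∀ l ∈ c, 0 < wt l.pos) (h : thr ≤ weight wt c) :
    thr ≤ weight wt (c.take thr) := by
  obtain hlen | hlen := le_total c.length thr
  · rwa [List.take_of_length_le hlen]
  · exact (List.length_take_of_le hlen).ge.trans
      (length_le_weight fun l hl => hc l (List.mem_of_mem_take hl))

theorem light_filter_iff (c : List Lit) (p : Lit → Prop) [DecidablePred p] :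
    Light wt thr (c.toFinset.filter p) ↔
      weight wt ((normalize wt c).filter fun l => decide (p l)) < thr := by
  have hnodup : ((normalize wt c).filter fun l => decide (p l)).Nodup :=
    (c.nodup_dedup.filter _).filter _
  rw [Light, weight, ← List.sum_toFinset _ hnodup]
  refine iff_of_eq (congrArg (· < thr) (Finset.sum_subset (fun l hl => ?_) fun l hl hl' => ?_).symm)
  · simp only [normalize, List.mem_toFinset, List.mem_filter, List.mem_dedup] at hl
    exact Finset.mem_filter.2 ⟨List.mem_toFinset.2 hl.1.1, of_decide_eq_true hl.2⟩
  · simp only [Finset.mem_filter, List.mem_toFinset] at hl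
    simpa [normalize, hl] using hl'

theorem isSolved_iff {cs : List (List Lit)} :
    isSolved wt thr cs = true ↔ ∀ c ∈ cs, weight wt c < thr := by
  simp [isSolved]

/-- Deleting the variables in `B` makes all clauses light. -/
def Solves (wt : Bool → ℕ) (thr : ℕ) (B : Finset Var) (cs : List (List Lit)) : Prop :=
  ∀ c ∈ cs, weight wt (c.filter fun l => decide (l.var ∉ B)) < thr

theorem solves_empty_iff {cs : List (List Lit)} :
    Solves wt thr ∅ cs ↔ ∀ c ∈ cs, weight wt c < thr := by
  simp [Solves]

theorem solves_map_filter_iff {B : Finset Var} {x : Var} {cs : List (List Lit)} :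
    Solves wt thr B (cs.map fun c => c.filter fun l => decide (l.var ≠ x)) ↔
      Solves wt thr (insert x B) cs := by
  simp only [Solves, List.forall_mem_map, List.filter_filter, Finset.mem_insert, not_or,
    Bool.decide_and, Bool.and_comm]

theorem exists_solves_of_solves_branch {B : Finset Var} {i : ℕ} {cs : List (List Lit)}
    (h : Solves wt thr B (branch wt thr i cs)) :
    ∃ B', B'.card ≤ B.card + 1 ∧ Solves wt thr B' cs := by
  rw [branch] at h
  split at h
  · exact ⟨B, B.card.le_succ, h⟩
  · exact ⟨_, Finset.card_insert_le _ _, solves_map_filter_iff.1 h⟩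

theorem exists_solves_of_foldl_branch (p : List (Fin thr)) {cs : List (List Lit)}
    (h : ∀ c ∈ p.foldl (fun cs i => branch wt thr i cs) cs, weight wt c < thr) :
    ∃ B : Finset Var, B.card ≤ p.length ∧ Solves wt thr B cs := by
  induction p generalizing cs with
  | nil => exact ⟨∅, le_rfl, solves_empty_iff.2 h⟩
  | cons i p ih =>
    obtain ⟨B, hBp, hB⟩ := ih h
    obtain ⟨B', hB'B, hB'⟩ := exists_solves_of_solves_branch hB
    exact ⟨B', hB'B.trans (Nat.succ_le_succ hBp), hB'⟩

theorem pos_of_mem_branch {i : ℕ} {cs : List (List Lit)}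
    (hcs : ∀ c ∈ cs, ∀ l ∈ c, 0 < wt l.pos) : ∀ c ∈ branch wt thr i cs, ∀ l ∈ c, 0 < wt l.pos := by
  rw [branch]
  split
  · exact hcs
  · exact List.forall_mem_map.2 fun c hc l hl => hcs c hc l (List.mem_of_mem_filter hl)

/-- The first `thr` literals of a heavy clause are already too heavy together. -/
theorem exists_solves_branch {B : Finset Var} {cs : List (List Lit)}
    (hcs : ∀ c ∈ cs, ∀ l ∈ c, 0 < wt l.pos) (hB : Solves wt thr B cs)
    (hheavy : ¬ ∀ c ∈ cs, weight wt c < thr) :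
    ∃ i < thr, ∃ B', B'.card + 1 = B.card ∧ Solves wt thr B' (branch wt thr i cs) := by
  obtain ⟨d, t, hdt⟩ : ∃ d t, cs.filter (fun c => decide (thr ≤ weight wt c)) = d :: t :=
    List.exists_cons_of_ne_nil fun h => hheavy (by simpa [List.filter_eq_nil_iff] using h)
  obtain ⟨hd, hdw⟩ := List.mem_filter.1 (hdt ▸ List.mem_cons_self)
  obtain ⟨l, hl, hlB⟩ : ∃ l ∈ d.take thr, l.var ∈ B := by
    by_contra! hn
    have hsub : (d.take thr).Sublist (d.filter fun l => decide (l.var ∉ B)) := by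
      rw [← List.filter_eq_self.2 fun l hl => decide_eq_true (hn l hl)]
      exact (List.take_sublist _ _).filter _
    exact ((le_weight_take (hcs d hd) (of_decide_eq_true hdw)).trans
      (weight_mono hsub)).not_gt (hB d hd)
  obtain ⟨i, hi, rfl⟩ := List.getElem_of_mem hl
  rw [List.length_take, lt_min_iff] at hi
  rw [List.getElem_take] at hlB
  refine ⟨i, hi.1, B.erase d[i].var, Finset.card_erase_add_one hlB, ?_⟩
  have hdrop : (candidates wt thr cs).drop i = d[i] :: (d.drop (i + 1) ++ t.flatten) := by
    rw [candidates, hdt, List.flatten_cons, List.drop_append_of_le_length hi.2.le,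
      List.drop_eq_getElem_cons hi.2, List.cons_append]
  simp only [branch, hdrop]
  rwa [solves_map_filter_iff, Finset.insert_erase hlB]

theorem exists_foldl_branch_of_solves (k : ℕ) {B : Finset Var} {cs : List (List Lit)}
    (hcs : ∀ c ∈ cs, ∀ l ∈ c, 0 < wt l.pos) (hk : B.card ≤ k) (hB : Solves wt thr B cs) :
    ∃ p : List (Fin thr), p.length ≤ k ∧
      ∀ c ∈ p.foldl (fun cs i => branch wt thr i cs) cs, weight wt c < thr := by
  induction k generalizing B cs with
  | zero =>
    rw [Nat.le_zero, Finset.card_eq_zero] at hk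
    exact ⟨[], le_rfl, solves_empty_iff.1 (hk ▸ hB)⟩
  | succ k ih =>
    by_cases hlight : ∀ c ∈ cs, weight wt c < thr
    · exact ⟨[], Nat.zero_le _, hlight⟩
    · obtain ⟨i, hi, B', hcard, hB'⟩ := exists_solves_branch hcs hB hlight
      obtain ⟨p, hp, hsolved⟩ := ih (pos_of_mem_branch hcs) (by omega) hB'
      exact ⟨⟨i, hi⟩ :: p, Nat.succ_le_succ hp, hsolved⟩

/-- The paths of length at most `k` in the search tree, in which every node has `m` children. -/
def paths (m : ℕ) : ℕ → List (List (Fin m))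
  | 0 => [[]]
  | k + 1 => [] :: (paths m k).flatMap fun p => (List.finRange m).map (· :: p)

theorem mem_paths {m k : ℕ} {p : List (Fin m)} : p ∈ paths m k ↔ p.length ≤ k := by
  induction k generalizing p with
  | zero => simp [paths]
  | succ k ih => cases p <;> simp [paths, ih]

/-- All paths of length at most `k`, each of them followed by the end mark `m`. This is the part
of the input of the search that depends on the parameter only. -/
def guide (m k : ℕ) : List (Fin (m + 1)) :=
  (paths m k).flatMap fun p => p.map Fin.castSucc ++ [Fin.last m]

theorem computable_guide (m : ℕ) : Computable (guide m) := by
  have hstep : Primrec fun L : List (List (Fin m)) =>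
      [] :: L.flatMap fun p => (List.finRange m).map (· :: p) :=
    Primrec.list_cons.comp (.const []) (Primrec.list_flatMap .id (Primrec.list_map (.const _)
      (Primrec.list_cons.comp .snd (Primrec.snd.comp .fst)).to₂).to₂)
  have hpaths : Primrec (paths m) :=
    (Primrec.nat_rec₁ [[]] (hstep.comp .snd).to₂).of_eq fun k => by
      induction k with
      | zero => rfl
      | succ k ih => rw [paths, ← ih]
  exact (Primrec.list_flatMap hpaths (Primrec.list_append.comp
    (Primrec.list_map .snd ((Primrec.dom_finite _).comp .snd).to₂) (.const _)).to₂).to_comp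

/-- One step of the search along a guide; the state consists of the current clauses and of the
information whether some path has succeeded so far. -/
def searchStep (wt : Bool → ℕ) (thr : ℕ) (cs : List (List Lit)) (s : List (List Lit) × Bool)
    (i : Fin (thr + 1)) : List (List Lit) × Bool :=
  bif decide (i = Fin.last thr) then (cs, s.2 || isSolved wt thr s.1)
  else (branch wt thr i s.1, s.2)

/-- The search for a solution along the paths that are listed by the guide `g`. -/
def search (wt : Bool → ℕ) (thr : ℕ) (cs : List (List Lit)) (g : List (Fin (thr + 1))) : Bool :=
  (g.foldl (searchStep wt thr cs) (cs, false)).2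

theorem foldl_searchStep_path (cs : List (List Lit)) (p : List (Fin thr))
    (s : List (List Lit) × Bool) :
    (p.map Fin.castSucc ++ [Fin.last thr]).foldl (searchStep wt thr cs) s =
      (cs, s.2 || isSolved wt thr (p.foldl (fun cs i => branch wt thr i cs) s.1)) := by
  induction p generalizing s with
  | nil => simp [searchStep]
  | cons i p ih =>
    rw [List.map_cons, List.cons_append, List.foldl_cons, ih]
    simp [searchStep, (Fin.castSucc_lt_last i).ne]

theorem foldl_searchStep_paths (cs : List (List Lit)) (ps : List (List (Fin thr))) (ok : Bool) :
    (ps.flatMap fun p => p.map Fin.castSucc ++ [Fin.last thr]).foldl (searchStep wt thr cs)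
      (cs, ok) =
    (cs, ok || ps.any fun p => isSolved wt thr (p.foldl (fun cs i => branch wt thr i cs) cs)) := by
  induction ps generalizing ok with
  | nil => simp
  | cons p ps ih =>
    rw [List.flatMap_cons, List.foldl_append, foldl_searchStep_path, ih, List.any_cons,
      Bool.or_assoc]

theorem search_guide_iff {cs : List (List Lit)} (hcs : ∀ c ∈ cs, ∀ l ∈ c, 0 < wt l.pos) (k : ℕ) :
    search wt thr cs (guide thr k) = true ↔
      ∃ B : Finset Var, B.card ≤ k ∧ Solves wt thr B cs := by
  rw [search, guide, foldl_searchStep_paths, Bool.false_or, List.any_eq_true]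
  simp only [mem_paths, isSolved_iff]
  refine ⟨fun ⟨p, hp, h⟩ => ?_, fun ⟨B, hk, hB⟩ => exists_foldl_branch_of_solves k hcs hk hB⟩
  obtain ⟨B, hBp, hB⟩ := exists_solves_of_foldl_branch p h
  exact ⟨B, hBp.trans hp, hB⟩

theorem search_normalize_guide_iff (cs : List (List Lit)) (k : ℕ) :
    search wt thr (cs.map (normalize wt)) (guide thr k) = true ↔
      ∃ B : Finset Var, B.card ≤ k ∧
        ∀ c ∈ cs, Light wt thr (c.toFinset.filter fun l => l.var ∉ B) := by
  have hpos : ∀ c ∈ cs.map (normalize wt), ∀ l ∈ c, 0 < wt l.pos :=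
    List.forall_mem_map.2 fun c _ l hl => of_decide_eq_true (List.mem_filter.1 hl).2
  rw [search_guide_iff hpos]
  simp only [Solves, List.forall_mem_map, light_filter_iff]

end DefaultLogic

/-! ### Decoding of words -/

namespace DefaultLogic

/-- The clauses of all formulas of a theory. -/
def TheoryCode.clauseList (c : TheoryCode) : List (List Lit) :=
  (c.W ++ c.D.flatMap fun r => [r.1, r.2.1, r.2.2]).flatten

theorem TheoryCode.forall_mem_clauses_theory_iff {c : TheoryCode} {P : Clause → Prop} :
    (∀ C ∈ c.theory.clauses, P C) ↔ ∀ d ∈ c.clauseList, P d.toFinset := by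
  have hformulas : c.theory.formulas =
      ((c.W ++ c.D.flatMap fun r => [r.1, r.2.1, r.2.2]).map CNFCode.toCNF).toFinset := by
    ext φ
    simp [DefaultTheory.formulas, theory, List.flatMap_map, List.map_flatMap]
  simp only [DefaultTheory.clauses, hformulas, Set.mem_ofPred_eq, List.mem_toFinset, List.mem_map,
    CNFCode.toCNF, clauseList, List.mem_flatten]
  constructor
  · exact fun h d ⟨φ, hφ, hd⟩ => h _ ⟨_, ⟨φ, hφ, rfl⟩, by simpa using ⟨d, hd, rfl⟩⟩
  · rintro h _ ⟨_, ⟨φ, hφ, rfl⟩, hC⟩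
    obtain ⟨d, hd, rfl⟩ := List.mem_map.1 (List.mem_toFinset.1 hC)
    exact h d ⟨φ, hφ, hd⟩

/-- The state of the decoder, which reads a word from right to left: the bits and the formulas that
have been read since the last mark, and the formulas that have been read before the mark `endW`. -/
abbrev DecoderState := List Bool × List CNFCode × List CNFCode

/-- The transition of the decoder. The formula that is being read is the first one of the list, and
the clause that is being read is the first one of this formula. -/
def decodeSym : Sym → DecoderState → DecoderState
  | .bit b, (bits, φs, ψs) => (b :: bits, φs, ψs)
  | .sign b, (bits, φs, ψs) =>
    ([], φs.modifyHead fun φ => φ.modifyHead fun c => ⟨bits, b⟩ :: c, ψs)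
  | .endClause, (bits, φs, ψs) => (bits, φs.modifyHead fun φ => [] :: φ, ψs)
  | .endFormula, (bits, φs, ψs) => (bits, [] :: φs, ψs)
  | .endW, (bits, φs, _) => (bits, [], φs)

/-- The transition of the grouping of a list into triples from right to left; the first component
of the state is an incomplete triple. -/
def groupTriple {α : Type} (a : α) : List α × List (α × α × α) → List α × List (α × α × α)
  | ([], ts) => ([a], ts)
  | ([b], ts) => ([a, b], ts)
  | (b :: c :: _, ts) => ([], (a, b, c) :: ts)

/-- The theory that is written down by a word, if there is any. -/
def decode (x : List Sym) : TheoryCode where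
  W := (x.foldr decodeSym ([], [], [])).2.1
  D := ((x.foldr decodeSym ([], [], [])).2.2.foldr groupTriple ([], [])).2

theorem foldr_decodeSym_bits (x : Var) (bits : List Bool) (φs ψs : List CNFCode) :
    (x.map Sym.bit).foldr decodeSym (bits, φs, ψs) = (x ++ bits, φs, ψs) := by
  induction x with
  | nil => rfl
  | cons b x ih => rw [List.map_cons, List.foldr_cons, ih]; rfl

theorem foldr_decodeSym_literals (c c' : List Lit) (φ : CNFCode) (φs ψs : List CNFCode) :
    (c.flatMap litWord).foldr decodeSym ([], (c' :: φ) :: φs, ψs) =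
      ([], ((c ++ c') :: φ) :: φs, ψs) := by
  induction c with
  | nil => rfl
  | cons l c ih =>
    rw [List.flatMap_cons, List.foldr_append, ih, litWord, List.foldr_cons, foldr_decodeSym_bits,
      List.append_nil]
    rfl

theorem foldr_decodeSym_clauses (φ φ' : CNFCode) (φs ψs : List CNFCode) :
    (φ.flatMap clauseWord).foldr decodeSym ([], φ' :: φs, ψs) = ([], (φ ++ φ') :: φs, ψs) := by
  induction φ with
  | nil => rfl
  | cons c φ ih =>
    rw [List.flatMap_cons, List.foldr_append, ih, clauseWord, List.foldr_append]
    exact (foldr_decodeSym_literals c [] _ _ _).trans (by rw [List.append_nil]; rfl)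

theorem foldr_decodeSym_formulas (φs φs' ψs : List CNFCode) :
    (φs.flatMap CNFCode.word).foldr decodeSym ([], φs', ψs) = ([], φs ++ φs', ψs) := by
  induction φs with
  | nil => rfl
  | cons φ φs ih =>
    rw [List.flatMap_cons, List.foldr_append, ih, CNFCode.word, List.foldr_append]
    exact (foldr_decodeSym_clauses φ [] _ _).trans (by rw [List.append_nil]; rfl)

theorem foldr_groupTriple {α : Type} (ts : List (α × α × α)) :
    (ts.flatMap fun r => [r.1, r.2.1, r.2.2]).foldr groupTriple ([], []) = ([], ts) := by
  induction ts with
  | nil => rfl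
  | cons r ts ih => rw [List.flatMap_cons, List.foldr_append, ih]; rfl

theorem decode_word (c : TheoryCode) : decode c.word = c := by
  have hD : (c.D.flatMap fun r => r.1.word ++ r.2.1.word ++ r.2.2.word) =
      (c.D.flatMap fun r => [r.1, r.2.1, r.2.2]).flatMap CNFCode.word := by
    simp only [List.flatMap_assoc, List.flatMap_cons, List.flatMap_nil, List.append_nil,
      List.append_assoc]
  have hfoldr : c.word.foldr decodeSym ([], [], []) =
      ([], c.W, c.D.flatMap fun r => [r.1, r.2.1, r.2.2]) := by
    rw [TheoryCode.word, hD, List.foldr_append, List.foldr_cons, foldr_decodeSym_formulas,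
      List.append_nil]
    exact (foldr_decodeSym_formulas _ _ _).trans (by rw [List.append_nil])
  rw [decode, hfoldr, foldr_groupTriple]

/-- The polynomial-time algorithm for the detection of backdoors, where the second argument is the
guide for the parameter. -/
def accepts (wt : Bool → ℕ) (thr : ℕ) (x : List Sym) (g : List (Fin (thr + 1))) : Bool :=
  decide ((decode x).word = x) && search wt thr ((decode x).clauseList.map (normalize wt)) g

theorem accepts_guide_iff {wt : Bool → ℕ} {thr : ℕ} {Θ : Set CNF} (h : IsWeighting wt thr Θ)
    (x : List Sym) (k : ℕ) :
    accepts wt thr x (guide thr k) = true ↔ (x, k) ∈ BackdoorDetection Θ := by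
  have hcorrect (c : TheoryCode) :
      search wt thr (c.clauseList.map (normalize wt)) (guide thr k) = true ↔
        ∃ B, IsStrongBackdoor Θ c.theory B ∧ B.card ≤ k := by
    simp only [h.exists_isStrongBackdoor_iff, TheoryCode.forall_mem_clauses_theory_iff,
      search_normalize_guide_iff]
  rw [accepts, Bool.and_eq_true, decide_eq_true_eq, hcorrect]
  refine ⟨fun ⟨hx, hB⟩ => ⟨_, hx, hB⟩, ?_⟩
  rintro ⟨c, rfl, hB⟩
  rw [decode_word]
  exact ⟨rfl, hB⟩

end DefaultLogic

/-! ### Running time of the search -/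

namespace DefaultLogic

open Coded

variable {A : Type} [Inhabited A] [Atomic A Bool]

section Literals

instance : Coded A Lit := ⟨fun l => code (l.var, l.pos)⟩

theorem polyTime_lit_mk : PolyTime A fun x : Var × Bool => Lit.mk x.1 x.2 :=
  .of_code_eq fun _ => rfl

theorem polyTime_var_pos : PolyTime A fun l : Lit => (l.var, l.pos) := .of_code_eq fun _ => rfl

theorem polyTime_var : PolyTime A Lit.var := PolyTime.fst.comp polyTime_var_pos

theorem polyTime_pos : PolyTime A Lit.pos := PolyTime.snd.comp polyTime_var_pos

theorem size_lit (l : Lit) : size A l = size A l.var + 2 := by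
  change size A (l.var, l.pos) = _
  rw [size_pair, size_atomic]

theorem polyTimeEq_lit : PolyTimeEq A Lit :=
  ((PolyTimeEq.atomic (α := Bool)).list.prod .atomic).of_injective
    polyTime_var_pos fun ⟨_, _⟩ ⟨_, _⟩ h => by
      obtain ⟨rfl, rfl⟩ := Prod.mk.inj h; rfl

end Literals

section Search

open PolyTime

variable (wt : Bool → ℕ) (thr : ℕ)

theorem polyTime_le_weight : PolyTime A fun c : List Lit => decide (thr ≤ weight wt c) := by
  let units (c : List Lit) : List Bool := c.flatMap fun l => List.replicate (wt l.pos) true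
  have hunits : PolyTime A units :=
    flatMap .id ((of_finite fun b => List.replicate (wt b) true).comp (polyTime_pos.comp snd))
  refine ((isEmpty.comp ((drop thr).comp (cons (const true) hunits))).not).of_eq fun c => ?_
  have hlength : (units c).length = weight wt c := by simp [units, weight, List.length_flatMap]
  rw [Bool.eq_iff_iff, decide_eq_true_iff, ← hlength]
  simp

theorem polyTime_normalize : PolyTime A (normalize wt) :=
  filter polyTimeEq_lit.dedup
    ((of_finite fun b => decide (0 < wt b)).comp (polyTime_pos.comp snd))

theorem polyTime_isSolved : PolyTime A (isSolved wt thr) :=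
  all .id ((polyTime_le_weight wt thr).comp snd).not

theorem polyTime_branch (i : ℕ) : PolyTime A (branch wt thr i) := by
  have hcandidates : PolyTime A (candidates wt thr) :=
    flatten (filter .id ((polyTime_le_weight wt thr).comp snd))
  have hdelete : PolyTime A fun x : (Lit × List Lit) × List (List Lit) =>
      x.2.map fun c => c.filter fun l => decide (l.var ≠ x.1.1.var) :=
    map snd (filter snd (((PolyTimeEq.atomic (α := Bool)).list.decide (polyTime_var.comp snd)
      (polyTime_var.comp (fst.comp (fst.comp (fst.comp fst))))).not.of_eq fun _ =>
        (decide_not).symm))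
  refine (listCases (g := fun cs a _ => cs.map fun c => c.filter fun l => decide (l.var ≠ a.var))
    ((drop i).comp hcandidates) .id hdelete).of_eq fun cs => ?_
  rw [branch]
  cases (candidates wt thr cs).drop i <;> rfl

theorem size_branch_le (i : ℕ) (cs : List (List Lit)) :
    size A (branch wt thr i cs) ≤ size A cs := by
  rw [branch]
  split
  · exact le_rfl
  · exact size_map_le (fun c => size_filter_le _ c) cs

theorem size_searchStep_le (cs : List (List Lit)) (s : List (List Lit) × Bool)
    (i : Fin (thr + 1)) : size A (searchStep wt thr cs s i) ≤ size A s + size A cs := by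
  have hbranch := size_branch_le (A := A) wt thr i s.1
  obtain ⟨cs', ok⟩ := s
  rw [searchStep]
  cases decide (i = Fin.last thr)
  · simp only [cond_false, size_pair, size_atomic] at hbranch ⊢; omega
  · simp only [cond_true, size_pair, size_atomic]; omega

theorem polyTime_search [Atomic A (Fin (thr + 1))] :
    PolyTime A fun x : List (List Lit) × List (Fin (thr + 1)) => search wt thr x.1 x.2 := by
  have hstep : PolyTime A fun x : (List (List Lit) × List (List Lit) × Bool) × Fin (thr + 1) =>
      searchStep wt thr x.1.1 x.1.2 x.2 :=
    (cases (f := fun i (x : List (List Lit) × List (List Lit) × Bool) =>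
      searchStep wt thr x.1 x.2 i) fun i =>
        (const (decide (i = Fin.last thr))).cond
          (fst.pair ((snd.comp snd).or ((polyTime_isSolved wt thr).comp (fst.comp snd))))
          (((polyTime_branch wt thr i).comp (fst.comp snd)).pair (snd.comp snd))).comp
      (snd.pair fst)
  exact snd.comp (foldl (f := fun x : List (List Lit) × List (Fin (thr + 1)) =>
    searchStep wt thr x.1) snd (fst.pair (const false))
    (hstep.comp (((fst.comp (fst.comp fst)).pair (snd.comp fst)).pair snd)) .size
    fun ⟨cs, _⟩ s i => (size_searchStep_le wt thr cs s i).trans (by simp only [size_pair]; omega))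

end Search

end DefaultLogic

namespace DefaultLogic

open Coded PolyTime

variable {A : Type} [Inhabited A]

section Grouping

variable {α : Type} [Coded A α]

theorem polyTime_groupTriple :
    PolyTime A fun x : α × List α × List (α × α × α) => groupTriple x.1 x.2 := by
  have hsecond : PolyTime A fun x : (α × List α) × α × List α × List (α × α × α) =>
      match x.1.2 with
      | [] => ([x.2.1, x.1.1], x.2.2.2)
      | c :: _ => ([], (x.2.1, x.1.1, c) :: x.2.2.2) :=
    listCases (g := fun x c _ => ([], (x.2.1, x.1.1, c) :: x.2.2.2)) (snd.comp fst)
      ((cons (fst.comp snd) (cons (fst.comp fst) (const []))).pair (snd.comp (snd.comp snd)))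
      ((const []).pair (cons
        ((fst.comp (snd.comp snd)).pair ((fst.comp (fst.comp snd)).pair (fst.comp fst)))
        (snd.comp (snd.comp (snd.comp snd)))))
  refine (listCases (l := fun x : α × List α × List (α × α × α) => x.2.1)
    (g := fun x b t => match t with
      | [] => ([x.1, b], x.2.2)
      | c :: _ => ([], (x.1, b, c) :: x.2.2))
    (fst.comp snd) ((cons fst (const [])).pair (snd.comp snd)) hsecond).of_eq fun x => ?_
  obtain ⟨a, _ | ⟨b, _ | ⟨c, t⟩⟩, ts⟩ := x <;> rfl

theorem size_groupTriple_le (a : α) (s : List α × List (α × α × α)) :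
    size A (groupTriple a s) ≤ size A s + (size A a + 2) := by
  obtain ⟨_ | ⟨b, _ | ⟨c, t⟩⟩, ts⟩ := s <;>
    simp only [groupTriple, size_pair, size_cons, size_nil] <;> omega

end Grouping

section TheoryCode

variable [Atomic A Bool]

instance : Coded A TheoryCode := ⟨fun c => code (c.W, c.D)⟩

theorem polyTime_W_D : PolyTime A fun c : TheoryCode => (c.W, c.D) := of_code_eq fun _ => rfl

theorem polyTime_clauseList : PolyTime A TheoryCode.clauseList :=
  flatten (append (fst.comp polyTime_W_D) (flatMap (snd.comp polyTime_W_D)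
    (cons (fst.comp snd) (cons (fst.comp (snd.comp snd))
      (cons (snd.comp (snd.comp snd)) (const []))))))

theorem size_decodeSym_le (s : Sym) (x : DecoderState) :
    size A (decodeSym s x) ≤ size A x + 4 := by
  obtain ⟨bits, φs, ψs⟩ := x
  cases s with
  | bit b => simp only [decodeSym, size_pair, size_cons, size_atomic]; omega
  | sign b =>
    have hlit : size A (⟨bits, b⟩ : Lit) = size A bits + 2 := size_lit _
    have h : size A (φs.modifyHead fun φ => φ.modifyHead fun c => ⟨bits, b⟩ :: c) ≤
        size A φs + (size A bits + 3) :=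
      size_modifyHead_le (size_modifyHead_le fun c => by rw [size_cons, hlit]; omega) φs
    simp only [decodeSym, size_pair, size_nil]
    omega
  | endClause =>
    have h := size_modifyHead_le (A := A) (f := fun φ : CNFCode => [] :: φ) (n := 2)
      (fun φ => by rw [size_cons, size_nil]; omega) φs
    simp only [decodeSym, size_pair]
    omega
  | endFormula => simp only [decodeSym, size_pair, size_cons, size_nil]; omega
  | endW => simp only [decodeSym, size_pair, size_nil]; omega

variable [Atomic A Sym]

theorem polyTime_decodeSym : PolyTime A fun x : Sym × DecoderState => decodeSym x.1 x.2 := by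
  refine cases fun s => ?_
  have hmodify {f : DecoderState → CNFCode → CNFCode}
      (hf : PolyTime A fun x : DecoderState × CNFCode => f x.1 x.2) :
      PolyTime A fun x : DecoderState => (x.2.1.modifyHead (f x), x.2.2) :=
    (modifyHead (fst.comp snd) hf).pair (snd.comp snd)
  cases s with
  | bit b => exact (cons (const b) fst).pair snd
  | sign b =>
    exact (const []).pair (hmodify (modifyHead snd
      (cons (polyTime_lit_mk.comp ((fst.comp (fst.comp fst)).pair (const b))) snd)))
  | endClause => exact fst.pair (hmodify (cons (const []) snd))
  | endFormula => exact fst.pair ((cons (const []) (fst.comp snd)).pair (snd.comp snd))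
  | endW => exact fst.pair ((const []).pair (fst.comp snd))

theorem polyTime_decode : PolyTime A decode := by
  have hsyms : PolyTime A fun x : List Sym => x.foldr decodeSym ([], [], []) :=
    foldr (f := fun _ => decodeSym) (g := fun _ => 4) .id (const _)
      (polyTime_decodeSym.comp ((snd.comp fst).pair snd)) (.const 4) fun _ => size_decodeSym_le
  have htriples : PolyTime A fun φs : List CNFCode => φs.foldr groupTriple ([], []) :=
    foldr (f := fun _ => groupTriple) (g := fun x => 1 * size A x.2 + 2) .id (const _)
      (polyTime_groupTriple.comp ((snd.comp fst).pair snd))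
      ((PolyBounded.mono .size fun x => by rw [size_pair]; omega).mul_add_const 1 2)
      fun _ φ s => by rw [one_mul]; exact size_groupTriple_le φ s
  exact (of_code_eq (f := fun x => TheoryCode.mk x.1 x.2) fun _ => rfl).comp
    ((fst.comp (snd.comp hsyms)).pair (snd.comp (htriples.comp (snd.comp (snd.comp hsyms)))))

theorem polyTime_word : PolyTime A TheoryCode.word := by
  have hlit : PolyTime A litWord :=
    cons ((of_finite Sym.sign).comp polyTime_pos)
      (map polyTime_var ((of_finite Sym.bit).comp snd))
  have hclause : PolyTime A clauseWord := append (flatMap .id (hlit.comp snd)) (const _)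
  have hformula : PolyTime A CNFCode.word := append (flatMap .id (hclause.comp snd)) (const _)
  exact append (flatMap (fst.comp polyTime_W_D) (hformula.comp snd))
    (cons (const Sym.endW) (flatMap (snd.comp polyTime_W_D)
      (append (append (hformula.comp (fst.comp snd)) (hformula.comp (fst.comp (snd.comp snd))))
        (hformula.comp (snd.comp (snd.comp snd))))))

theorem polyTime_accepts (wt : Bool → ℕ) (thr : ℕ) [Atomic A (Fin (thr + 1))] :
    PolyTime A fun x : List Sym × List (Fin (thr + 1)) => accepts wt thr x.1 x.2 :=
  (PolyTimeEq.atomic.list.decide (polyTime_word.comp (polyTime_decode.comp fst)) fst).and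
    ((polyTime_search wt thr).comp
      ((map (polyTime_clauseList.comp (polyTime_decode.comp fst))
        ((polyTime_normalize wt).comp snd)).pair snd))

end TheoryCode

end DefaultLogic

section Pairs

variable {B C : Type}

instance : Atomic (B ⊕ C) B := ⟨.inl⟩

instance : Atomic (B ⊕ C) C := ⟨.inr⟩

theorem PolyTime.inP [Fintype B] [Fintype C] [Inhabited (B ⊕ C)] [Atomic (B ⊕ C) Bool]
    {f : List B × List C → Bool} (hf : PolyTime (B ⊕ C) f) :
    DefaultLogic.InP (Computability.encodingProd (Computability.encodingList B)
      (Computability.encodingList C)) {x | f x = true} := by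
  let word (x : List B × List C) : List (B ⊕ C) := x.1.map .inl ++ x.2.map .inr
  let left (w : List (B ⊕ C)) : List B := w.flatMap (Sum.elim ([·]) fun _ => [])
  let right (w : List (B ⊕ C)) : List C := w.flatMap (Sum.elim (fun _ => []) ([·]))
  have hleft : PolyTime (B ⊕ C) left :=
    flatMap .id ((of_finite (Sum.elim ([·]) fun _ => [])).comp snd)
  have hright : PolyTime (B ⊕ C) right :=
    flatMap .id ((of_finite (Sum.elim (fun _ => []) ([·]))).comp snd)
  have hword (x) : (left (word x), right (word x)) = x := by
    ext1 <;> simp [left, right, word, List.flatMap_map]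
  have hf_word : (fun x => f (left (word x), right (word x))) = f :=
    funext fun x => congrArg f (hword x)
  refine ⟨f, fun _ => Iff.rfl, ?_⟩
  rw [← hf_word]
  exact (hf.comp (hleft.pair hright)).nonempty_tm2ComputableInPolyTime word

end Pairs

namespace DefaultLogic

instance {C : Type} : Atomic (Sym ⊕ C) Bool :=
  ⟨fun b => .inl (.bit b), fun _ _ h => Sym.bit.inj (Sum.inl.inj h)⟩

theorem fpt_backdoorDetection {wt : Bool → ℕ} {thr : ℕ} {Θ : Set CNF} (h : IsWeighting wt thr Θ) :
    FPT (BackdoorDetection Θ) :=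
  ⟨thr + 1, guide thr, _, computable_guide thr, (polyTime_accepts wt thr).inP,
    fun x k => (accepts_guide_iff h x k).symm⟩

end DefaultLogic

theorem mainTheorem2 :
    (∀ Θ ∈ ({DefaultLogic.Horn, DefaultLogic.PosUnit, DefaultLogic.Krom,
        DefaultLogic.Monotone} : Set (Set DefaultLogic.CNF)),
      DefaultLogic.FPT (DefaultLogic.BackdoorDetection Θ)) ∧
    ∀ (T : DefaultLogic.DefaultTheory) (B : Finset DefaultLogic.Var), B ⊆ T.vars →
      (DefaultLogic.IsStrongBackdoor DefaultLogic.Horn T B ↔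
        (DefaultLogic.hornGraph T).IsVertexCover (B : Set DefaultLogic.Var)) ∧
      (DefaultLogic.IsStrongBackdoor DefaultLogic.PosUnit T B ↔
        (DefaultLogic.primalGraph T).IsVertexCover (B : Set DefaultLogic.Var) ∧
          DefaultLogic.negVars T ⊆ (B : Set DefaultLogic.Var)) ∧
      (T.TautologyFree →
        (DefaultLogic.IsStrongBackdoor DefaultLogic.Krom T B ↔
          DefaultLogic.IsHittingSet (DefaultLogic.kromHypergraph T) B)) ∧
      (DefaultLogic.IsStrongBackdoor DefaultLogic.Monotone T B ↔
        DefaultLogic.negVars T ⊆ (B : Set DefaultLogic.Var)) := by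
  refine ⟨fun Θ hΘ => ?_, fun T B hB => ⟨DefaultLogic.isStrongBackdoor_horn_iff T B hB,
    DefaultLogic.isStrongBackdoor_posUnit_iff T B hB,
    fun hT => DefaultLogic.isStrongBackdoor_krom_iff T B hB hT,
    DefaultLogic.isStrongBackdoor_monotone_iff T B hB⟩⟩
  obtain ⟨wt, thr, h⟩ := DefaultLogic.exists_isWeighting hΘ
  exact DefaultLogic.fpt_backdoorDetection h
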